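/- Let $g>0$, let $\pi_1$ be the fundamental group of the compact oriented surface $\Sigma_{g,1}$ of genus $g$ with one boundary component, based at a boundary point, identified with the free group on $\mathbf u_1,\mathbf v_1,\dots,\mathbf u_g,\mathbf v_g$ so that the boundary has class $\partial=\prod_{i=1}^g[\mathbf u_i,\mathbf v_i]$, and let $\mathcal M_{g,1}=\{\varphi\in\mathrm{Aut}(\pi_1):\varphi(\partial)=\partial\}$ be the mapping class group (in the form of Dehn–Nielsen). Let $H=\pi_1^{ab}\otimes\mathbb Q$, write $[\mathbf a]\in H$ for the class of $\mathbf a\in\pi_1$, let $\widehat T=\prod_{n\ge0}H^{\otimes n}$ be the completed tensor algebra, $\widehat T_1=\prod_{n\ge 1}H^{\otimes n}$, and let $\mathcal L\subset\bigoplus_n H^{\otimes n}$ be the free Lie algebra on $H$, i.e. the Lie subalgebra generated by $H$, with $\mathcal L_n=\mathcal L\cap H^{\otimes n}$. For $X,Y\in\widehat T_1$ put $h(X,Y)=\log(\exp X\exp Y)-X-Y$. A generalized Magnus expansion is a group homomorphism $\theta:\pi_1\to1+\widehat T_1$ with $\theta(\mathbf a)=1+[\mathbf a]+(\text{terms of degree}\ge2)$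 for all $\mathbf a\in\pi_1$. A trivalent bordered fatgraph $G$ of genus $g$ is a finite connected graph with a cyclic ordering of the half-edges at each vertex, all of whose vertices have valence three except for a single univalent one, with a single boundary cycle, such that gluing a disk along the boundary cycle gives a closed surface of genus $g$. Here the boundary cycle follows an oriented edge pointing into a vertex by the oriented edge pointing out of that vertex that is next in the cyclic ordering. The tail $\mathbf t$ is the edge at the univalent vertex, oriented away from it; $\bar{\mathbf x}$ is the oriented edge $\mathbf x$ reversed. A marking of $G$ is a map $\pi$ from the set $\mathcal E_{or}(G)$ of oriented edges to $\pi_1$ such that $\pi(\bar{\mathbf x})\pi(\mathbf x)=1$; $\pi(\mathbf e_1)\pi(\mathbf e_2)\pi(\mathbf e_3)=1$ whenever $\mathbf e_1,\mathbf e_2,\mathbf e_3$ are the oriented edges pointing into a trivalent vertex, in cyclic order; the image of $\pi$ generates $\pi_1$; and $\pi(\bar{\mathbf t})=\partial$. Its $H$-marking is $\mathbf x\mapsto[\pi(\mathbf x)]$. For $\varphi\in\mathcal M_{g,1}$, $\varphi(G)$ denotes $G$ with the marking $\varphi\circ\pi$. For $\mathbf x\in\mathcal E_{or}(G)$ let $\mathbf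 f_0=\mathbf x,\mathbf f_1,\dots,\mathbf f_k=\bar{\mathbf x}$ be the path from $\mathbf x$ to $\bar{\mathbf x}$ along the boundary cycle. It is said to avoid the tail if it does not contain the step from $\bar{\mathbf t}$ to $\mathbf t$ around the univalent vertex. **Theorem.** For each trivalent marked bordered fatgraph $G$ of genus $g$ there is exactly one map $\ell^G$ on $\mathcal E_{or}(G)$ with values in $\widehat T$ such that $\ell^G_0(\mathbf x)=0$, $\ell^G_1(\mathbf x)=[\pi(\mathbf x)]$ and, for all $n\ge2$, $$\ell^G_n(\mathbf x)=-\frac13\sum_{i=1}^k h\big(\ell^G(\mathbf f_{i-1}),-\ell^G(\mathbf f_i)\big)_{(n)}$$ if the path from $\mathbf x$ to $\bar{\mathbf x}$ avoids the tail, and $\ell^G_n(\mathbf x)=-\ell^G_n(\bar{\mathbf x})$ otherwise; moreover $\ell^G_n(\mathbf x)\in\mathcal L_n$ for all $n$. The map $\theta^G(\mathbf x)=\exp(\ell^G(\mathbf x))$ on $\mathcal E_{or}(G)$ extends along the marking to a generalized Magnus expansion $\theta^G:\pi_1\to1+\widehat T_1$, that is, $\theta^G(\pi(\mathbf x))=\exp(\ell^G(\mathbf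 x))$ for all $\mathbf x\in\mathcal E_{or}(G)$, and this extension is unique. On oriented edges $\theta^G$ depends only on the combinatorics and the $H$-marking of $G$: if an isomorphism of the underlying fatgraphs of $G$ and $G'$ takes the $H$-marking of $G$ to that of $G'$, it takes $\theta^G$ on $\mathcal E_{or}(G)$ to $\theta^{G'}$ on $\mathcal E_{or}(G')$. Finally, $\theta^G$ is $\mathcal M_{g,1}$-equivariant: $$\theta^G(\mathbf x)=|\varphi^{-1}|\,\theta^{\varphi(G)}(\varphi(\mathbf x))\qquad\text{for all }\varphi\in\mathcal M_{g,1},\ \mathbf x\in\pi_1,$$ where $|\varphi^{-1}|$ denotes the map on $\widehat T$ induced by the action of $\varphi^{-1}$ on $H$. -/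

import Mathlib

universe u

noncomputable section

namespace FatgraphMagnus

/-! ### The completed tensor algebra -/

section Tensor

variable (V : Type*) [AddCommGroup V] [Module ℚ V]

/-- The tensor power `V^{⊗ n}`, as the homogeneous part of degree `n` of the tensor algebra. -/
abbrev tensorPower (n : ℕ) : Submodule ℚ (TensorAlgebra ℚ V) :=
  LinearMap.range (TensorAlgebra.ι ℚ : V →ₗ[ℚ] TensorAlgebra ℚ V) ^ n

/-- The completed tensor algebra `∏ n, V^{⊗ n}`. An element is a sequence `(X n)` with
`X n ∈ V^{⊗ n}`, written as the power series `∑ X n * z ^ n` in a central bookkeeping variable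
`z`, so that the product is the Cauchy product `(X * Y) n = ∑_{i + j = n} X i * Y j`. -/
def CompletedTensorAlgebra : Subalgebra ℚ (PowerSeries (TensorAlgebra ℚ V)) where
  carrier := {X | ∀ n, PowerSeries.coeff n X ∈ tensorPower V n}
  mul_mem' := by
    intro X Y hX hY n
    rw [PowerSeries.coeff_mul]
    refine Submodule.sum_mem _ fun p hp => ?_
    rw [← Finset.HasAntidiagonal.mem_antidiagonal.mp hp, tensorPower, pow_add]
    exact Submodule.mul_mem_mul (hX p.1) (hY p.2)
  add_mem' := by
    intro X Y hX hY n
    rw [map_add]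
    exact Submodule.add_mem _ (hX n) (hY n)
  algebraMap_mem' := by
    intro r n
    rw [PowerSeries.algebraMap_apply, PowerSeries.coeff_C]
    split_ifs with h
    · subst h
      rw [tensorPower, pow_zero]
      exact Submodule.mem_one.mpr ⟨r, rfl⟩
    · exact Submodule.zero_mem _

end Tensor

section TensorOps

variable {V : Type*} [AddCommGroup V] [Module ℚ V]

/-- The component of degree `n`. -/
def comp (n : ℕ) (X : CompletedTensorAlgebra V) : TensorAlgebra ℚ V :=
  PowerSeries.coeff n (X : PowerSeries (TensorAlgebra ℚ V))

theorem comp_mem (n : ℕ) (X : CompletedTensorAlgebra V) : comp n X ∈ tensorPower V n :=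
  X.2 n

/-- The element of the completed tensor algebra with prescribed components. -/
def ofComp (X : ℕ → TensorAlgebra ℚ V) (hX : ∀ n, X n ∈ tensorPower V n) :
    CompletedTensorAlgebra V :=
  ⟨PowerSeries.mk X, fun n => by rw [PowerSeries.coeff_mk]; exact hX n⟩

/-- The inclusion of `V` as the homogeneous part of degree one. -/
def ofDegreeOne (v : V) : CompletedTensorAlgebra V :=
  ofComp (fun k => if k = 1 then TensorAlgebra.ι ℚ v else 0) fun k => by
    split_ifs with h
    · subst h
      rw [tensorPower, pow_one]
      exact ⟨v, rfl⟩
    · exact Submodule.zero_mem _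

/-- The homogeneous part of degree `n`, as an element of the completed tensor algebra. -/
def homogeneousPart (n : ℕ) (X : CompletedTensorAlgebra V) : CompletedTensorAlgebra V :=
  ofComp (fun k => if k = n then comp k X else 0) fun k => by
    split_ifs
    · exact comp_mem k X
    · exact Submodule.zero_mem _

/-- The sum `∑ c k • X ^ k` of a formal power series at an element `X` whose component of degree
zero vanishes: then `X ^ k` has no component of degree less than `k`, so that only the powers
with `k ≤ n` contribute to the component of degree `n`. -/
def evalSeries (c : ℕ → ℚ) (X : CompletedTensorAlgebra V) : CompletedTensorAlgebra V :=
  ofComp (fun n => ∑ k ∈ Finset.range (n + 1), c k • comp n (X ^ k)) fun n =>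
    Submodule.sum_mem _ fun k _ => Submodule.smul_mem _ _ (comp_mem n (X ^ k))

/-- `exp X = ∑ X ^ k / k!`, for `X` with vanishing component of degree zero. -/
def expT (X : CompletedTensorAlgebra V) : CompletedTensorAlgebra V :=
  evalSeries (fun k => 1 / (k.factorial : ℚ)) X

/-- `log U = ∑_{k ≥ 1} (-1) ^ (k + 1) (U - 1) ^ k / k`, for `U` with component one in degree
zero. -/
def logT (U : CompletedTensorAlgebra V) : CompletedTensorAlgebra V :=
  evalSeries (fun k => if k = 0 then 0 else (-1 : ℚ) ^ (k + 1) / (k : ℚ)) (U - 1)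

/-- The nonlinear part `h(X, Y) = log (exp X exp Y) - X - Y` of the Hausdorff series. -/
def hausdorff (X Y : CompletedTensorAlgebra V) : CompletedTensorAlgebra V :=
  logT (expT X * expT Y) - X - Y

attribute [local instance] LieRing.ofAssociativeRing in
variable (V) in
/-- The free Lie algebra on `V`, realized as the Lie subalgebra of the tensor algebra (with the
commutator bracket) generated by `V`. Its homogeneous part of degree `n` is its intersection with
`V^{⊗ n}`. -/
def freeLie : Submodule ℚ (TensorAlgebra ℚ V) :=
  (LieSubalgebra.lieSpan ℚ (TensorAlgebra ℚ V)
    (Set.range (TensorAlgebra.ι ℚ : V → TensorAlgebra ℚ V))).toSubmodule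

/-- The map induced by a linear map on tensor algebras. -/
def tensorMap {W : Type*} [AddCommGroup W] [Module ℚ W] (f : V →ₗ[ℚ] W) :
    TensorAlgebra ℚ V →ₐ[ℚ] TensorAlgebra ℚ W :=
  TensorAlgebra.lift ℚ (TensorAlgebra.ι ℚ ∘ₗ f)

theorem tensorMap_mem {W : Type*} [AddCommGroup W] [Module ℚ W] (f : V →ₗ[ℚ] W) (n : ℕ)
    {X : TensorAlgebra ℚ V} (hX : X ∈ tensorPower V n) : tensorMap f X ∈ tensorPower W n := by
  have h1 : Submodule.map (tensorMap f).toLinearMap (tensorPower V 1) ≤ tensorPower W 1 := by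
    rw [tensorPower, tensorPower, pow_one, pow_one]
    rintro _ ⟨_, ⟨v, rfl⟩, rfl⟩
    refine ⟨f v, ?_⟩
    simp [tensorMap]
  have h2 : Submodule.map (tensorMap f).toLinearMap (tensorPower V n) ≤ tensorPower W n := by
    rw [tensorPower, tensorPower, pow_one, pow_one] at h1
    rw [tensorPower, Submodule.map_pow, tensorPower]
    exact pow_le_pow_left' h1 n
  exact h2 ⟨X, hX, rfl⟩

/-- The map induced by a linear map on completed tensor algebras: in degree `n` it sends
`v 1 ⊗ ⋯ ⊗ v n` to `f (v 1) ⊗ ⋯ ⊗ f (v n)`. -/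
def completedTensorMap {W : Type*} [AddCommGroup W] [Module ℚ W] (f : V →ₗ[ℚ] W)
    (X : CompletedTensorAlgebra V) : CompletedTensorAlgebra W :=
  ofComp (fun n => tensorMap f (comp n X)) fun n => tensorMap_mem f n (comp_mem n X)

end TensorOps

/-! ### Rational homology of a group and generalized Magnus expansions -/

section Magnus

/-- The rational homology `F^{ab} ⊗ ℚ`. -/
abbrev RatHomology (F : Type*) [Group F] : Type _ :=
  TensorProduct ℤ ℚ (Additive (Abelianization F))

variable {F : Type*} [Group F]

/-- The class `[a]` of a group element in rational homology. -/
def homologyClass (a : F) : RatHomology F :=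
  (1 : ℚ) ⊗ₜ[ℤ] Additive.ofMul (Abelianization.of a)

/-- The map `|φ|` induced by a group automorphism on rational homology. -/
def homologyMap (φ : MulAut F) : RatHomology F →ₗ[ℚ] RatHomology F :=
  LinearMap.baseChange ℚ
    (MonoidHom.toAdditive (Abelianization.map (φ : F ≃* F).toMonoidHom)).toIntLinearMap

/-- A generalized Magnus expansion of `F` over `ℚ`: a group homomorphism `θ` from `F` to the
multiplicative group of elements `1 + (terms of degree ≥ 1)` of the completed tensor algebra of
the rational homology, such that `θ a = 1 + [a] + (terms of degree ≥ 2)`. -/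
def IsGeneralizedMagnusExpansion (θ : F →* CompletedTensorAlgebra (RatHomology F)) : Prop :=
  ∀ a, comp 0 (θ a) = 1 ∧ comp 1 (θ a) = TensorAlgebra.ι ℚ (homologyClass a)

end Magnus

/-! ### The fundamental group of the surface and the mapping class group -/

/-- The fundamental group of the compact oriented surface of genus `g` with one boundary
component, based at a boundary point: the free group on `u 1, …, u g` (the generators `inl i`)
and `v 1, …, v g` (the generators `inr i`). -/
abbrev SurfaceGroup (g : ℕ) : Type := FreeGroup (Fin g ⊕ Fin g)

/-- The class `[u 1, v 1] ⋯ [u g, v g]` of the boundary of the surface. -/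
def boundaryWord (g : ℕ) : SurfaceGroup g :=
  (List.ofFn fun i : Fin g =>
    FreeGroup.of (Sum.inl i) * FreeGroup.of (Sum.inr i) *
      (FreeGroup.of (Sum.inl i))⁻¹ * (FreeGroup.of (Sum.inr i))⁻¹).prod

/-- The mapping class group of the surface relative to its boundary, in the form of Dehn and
Nielsen: the automorphisms of the fundamental group that fix the class of the boundary. -/
def mappingClassGroup (g : ℕ) : Subgroup (MulAut (SurfaceGroup g)) :=
  MulAction.stabilizer (MulAut (SurfaceGroup g)) (boundaryWord g)

/-! ### Fatgraphs -/

/-- A fatgraph: a finite connected graph with a cyclic ordering of the half edges at each vertex.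
`E` is the set of oriented edges and `bar` reverses the orientation. A half edge at a vertex `v`
is recorded as the oriented edge pointing into `v` along it, and `next` sends it to the following
one in the cyclic ordering at `v`. Thus the vertices are the cycles of `next`. -/
structure Fatgraph where
  E : Type u
  finite : Finite E
  bar : Equiv.Perm E
  next : Equiv.Perm E
  bar_bar : ∀ x, bar (bar x) = x
  bar_ne : ∀ x, bar x ≠ x
  connected : ∀ x y, ∃ s ∈ Subgroup.closure ({bar, next} : Set (Equiv.Perm E)), s x = y

/-- The number of cycles (fixed points included) of a permutation. -/
def numCycles {α : Type*} (f : Equiv.Perm α) : ℕ :=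
  Nat.card (Quotient (Equiv.Perm.SameCycle.setoid f))

namespace Fatgraph

/-- The step along a boundary cycle: from an edge pointing into a vertex to the edge pointing
out of it that is next in the cyclic ordering. -/
def boundary (G : Fatgraph) : Equiv.Perm G.E :=
  G.next.trans G.bar

/-- `G` has genus `g`: gluing a 2-cell along each boundary cycle gives a closed surface of Euler
characteristic `V - E + F = 2 - 2 g`. -/
def HasGenus (G : Fatgraph) (g : ℕ) : Prop :=
  numCycles G.next + numCycles G.boundary + 2 * g = numCycles G.bar + 2

end Fatgraph

/-- A trivalent (once-)bordered fatgraph: there is a single boundary cycle, and all vertices have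
valence three except for a single univalent one. `tail` is the tail, oriented so that it points
away from the univalent vertex. -/
structure BorderedFatgraph extends Fatgraph.{u} where
  tail : E
  univalent : next (bar tail) = bar tail
  trivalent : ∀ x, x ≠ bar tail → next x ≠ x ∧ next (next (next x)) = x
  one_boundary : ∀ x y, toFatgraph.boundary.SameCycle x y

namespace BorderedFatgraph

variable (G : BorderedFatgraph.{u})

theorem exists_boundary_pow (x y : G.E) : ∃ k : ℕ, (G.boundary ^ k) x = y := by
  have := G.finite
  obtain ⟨k, _, hk⟩ := (G.one_boundary x y).exists_pow_eq'
  exact ⟨k, hk⟩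

open Classical in
/-- The number of steps that lead along the boundary cycle from `x` to `bar x`. -/
def pathLength (x : G.E) : ℕ := Nat.find (G.exists_boundary_pow x (G.bar x))

/-- The edge-path `x = f 0, f 1, …` along the boundary cycle. -/
def path (x : G.E) (i : ℕ) : G.E := (G.boundary ^ i) x

/-- The edge-path from `x` to `bar x` along the boundary cycle avoids the tail, i.e. it does not
turn around at the univalent vertex (which it would do in the step from `bar tail` to `tail`).
For `x` other than `tail` and `bar tail` this says that neither of these lies on the path. The
path from `tail` to `bar tail`, the whole boundary cycle, qualifies. -/
def AvoidsTail (x : G.E) : Prop := ∀ i < G.pathLength x, G.path x i ≠ G.bar G.tail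

variable {V : Type*} [AddCommGroup V] [Module ℚ V]

/-- `∑_{i = 1}^{k} h(L (f (i - 1)), - L (f i))` along the edge-path `f 0, …, f k` from `x` to
`bar x`. -/
def pathSum (L : G.E → CompletedTensorAlgebra V) (x : G.E) : CompletedTensorAlgebra V :=
  ∑ i ∈ Finset.range (G.pathLength x), hausdorff (L (G.path x i)) (-L (G.path x (i + 1)))

open Classical in
/-- The approximations of `ell` that consist of the terms of degree at most `n`. The term of
degree one is the given marking `m`, and the term of degree `n + 2` is computed from those of
lower degree. -/
def ellApprox (m : G.E → V) : ℕ → G.E → CompletedTensorAlgebra V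
  | 0 => fun _ => 0
  | 1 => fun x => ofDegreeOne (m x)
  | n + 2 => fun x => ellApprox m (n + 1) x + homogeneousPart (n + 2)
      (if G.AvoidsTail x then (-(1 / 3 : ℚ)) • G.pathSum (ellApprox m (n + 1)) x
        else (1 / 3 : ℚ) • G.pathSum (ellApprox m (n + 1)) (G.bar x))

/-- The map `ℓ` on oriented edges, determined by the fatgraph and a marking `m` of its oriented
edges by elements of `V`. -/
def ell (m : G.E → V) (x : G.E) : CompletedTensorAlgebra V :=
  ofComp (fun n => comp n (G.ellApprox m n x)) fun n => comp_mem n _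

/-- The recursion for `ℓ`: `ℓ_0(x) = 0`, `ℓ_1(x) = m x`, and for `n ≥ 2`
`ℓ_n(x) = -(1/3) ∑_{i = 1}^{k} h(ℓ(f (i - 1)), -ℓ(f i))_(n)` if the path from `x` to `bar x`
avoids the tail, and `ℓ_n(x) = -ℓ_n(bar x)` otherwise. -/
def SolvesRecursion (m : G.E → V) (L : G.E → CompletedTensorAlgebra V) : Prop :=
  ∀ x, comp 0 (L x) = 0 ∧ comp 1 (L x) = TensorAlgebra.ι ℚ (m x) ∧
    ∀ n, 2 ≤ n →
      (G.AvoidsTail x → comp n (L x) = (-(1 / 3 : ℚ)) •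
        ∑ i ∈ Finset.range (G.pathLength x),
          comp n (hausdorff (L (G.path x i)) (-L (G.path x (i + 1))))) ∧
      (¬ G.AvoidsTail x → comp n (L x) = -comp n (L (G.bar x)))

end BorderedFatgraph

/-- A trivalent marked bordered fatgraph of genus `g`, the marking being given by elements of the
fundamental group on the oriented edges. -/
structure MarkedFatgraph (g : ℕ) extends BorderedFatgraph.{u} where
  genus : toFatgraph.HasGenus g
  marking : E → SurfaceGroup g
  orientation : ∀ x, marking (bar x) * marking x = 1
  vertex : ∀ x, x ≠ bar tail → marking x * marking (next x) * marking (next (next x)) = 1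
  full_rank : Subgroup.closure (Set.range marking) = ⊤
  geometric : marking (bar tail) = boundaryWord g

namespace MarkedFatgraph

variable {g : ℕ}

/-- The `H`-marking of a marked fatgraph. -/
def hMarking (G : MarkedFatgraph.{u} g) (x : G.E) : RatHomology (SurfaceGroup g) :=
  homologyClass (G.marking x)

/-- `θ(x) = exp (ℓ(x))` on the oriented edges of a marked fatgraph. -/
def theta (G : MarkedFatgraph.{u} g) (x : G.E) :
    CompletedTensorAlgebra (RatHomology (SurfaceGroup g)) :=
  expT (G.ell G.hMarking x)

/-- The marked fatgraph `φ(G)`: the fatgraph `G`, its marking composed with `φ`. -/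
def act (φ : mappingClassGroup g) (G : MarkedFatgraph.{u} g) : MarkedFatgraph.{u} g where
  toBorderedFatgraph := G.toBorderedFatgraph
  genus := G.genus
  marking x := φ.1 (G.marking x)
  orientation x := by rw [← map_mul, G.orientation, map_one]
  vertex x hx := by rw [← map_mul, ← map_mul, G.vertex x hx, map_one]
  full_rank := by
    have h : Set.range (fun x => φ.1 (G.marking x)) =
        (φ.1 : SurfaceGroup g ≃* SurfaceGroup g).toMonoidHom '' Set.range G.marking := by
      ext y
      simp
    rw [h, ← MonoidHom.map_closure, G.full_rank]
    exact Subgroup.map_top_of_surjective _ (MulEquiv.surjective φ.1)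
  geometric := by rw [G.geometric]; exact φ.2

/-- An isomorphism of the underlying fatgraphs of `G` and `G'` that matches their `H`-markings. -/
structure HIso (G G' : MarkedFatgraph.{u} g) where
  toEquiv : G.E ≃ G'.E
  map_bar : ∀ x, toEquiv (G.bar x) = G'.bar (toEquiv x)
  map_next : ∀ x, toEquiv (G.next x) = G'.next (toEquiv x)
  map_hMarking : ∀ x, G'.hMarking (toEquiv x) = G.hMarking x

end MarkedFatgraph

end FatgraphMagnus

end

open FatgraphMagnus

/-! The recursion is well posed because h(X, Y) in degree n involves X and Y only in degrees below n
(`hausdorff_sub_mem`). Its solution is unique and is Lie-valued by the Baker–Campbell–Hausdorff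
theorem (`hausdorff_mem_lieBelow`). The core is that exp ℓ satisfies the marking relations.
Antisymmetry under `bar` is built into the recursion. The vertex relation exp ℓ(x) exp ℓ(y) exp ℓ(z)
= 1 (`SolvesRecursion.expT_vertex`) is proved by induction on the degree. If it holds below degree
n, its failure in degree n is ℓ(x) + ℓ(y) + ℓ(z) + h(ℓ(x), ℓ(y)), and h takes the same value in
degree n at all three corners of the vertex. The path sums telescope around a vertex to the three
corner terms (`sum_vertex_eq`), so the coefficient -1/3 makes the sum of the three ℓ_n equal to
minus one corner term, and the failure vanishes. To extend along the marking, take the tree of edges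
along which the boundary cycle first arrives at each trivalent vertex. By the Euler characteristic
its complement has 2g edges, and the relations express every edge through them. The free group on
these edges surjects onto a free group of rank 2g, hence is isomorphic to it by the Hopf property,
and every solution of the relations extends (`exists_extension`). Dependence on the H-marking alone
and equivariance both follow from uniqueness of the solution, transported by an isomorphism of
fatgraphs or by a linear map of H. -/

namespace FatgraphMagnus

/-! ### Components and the degree filtration. -/

section Components

variable {V : Type*} [AddCommGroup V] [Module ℚ V]

theorem ext_comp {X Y : CompletedTensorAlgebra V} (h : ∀ n, comp n X = comp n Y) : X = Y :=
  Subtype.ext (PowerSeries.ext h)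

@[simp]
theorem comp_ofComp (n : ℕ) (X : ℕ → TensorAlgebra ℚ V) (hX : ∀ n, X n ∈ tensorPower V n) :
    comp n (ofComp X hX) = X n :=
  PowerSeries.coeff_mk _ _

variable (V) in
/-- The component of degree `n` as a linear map. -/
noncomputable def compLin (n : ℕ) : CompletedTensorAlgebra V →ₗ[ℚ] TensorAlgebra ℚ V where
  toFun := comp n
  map_add' X Y := by
    simp only [comp, Subalgebra.coe_add, map_add]
  map_smul' _ _ := rfl

@[simp]
theorem comp_zero (n : ℕ) : comp n (0 : CompletedTensorAlgebra V) = 0 :=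
  map_zero (compLin V n)

@[simp]
theorem comp_add (n : ℕ) (X Y : CompletedTensorAlgebra V) :
    comp n (X + Y) = comp n X + comp n Y :=
  map_add (compLin V n) X Y

@[simp]
theorem comp_sub (n : ℕ) (X Y : CompletedTensorAlgebra V) :
    comp n (X - Y) = comp n X - comp n Y :=
  map_sub (compLin V n) X Y

@[simp]
theorem comp_neg (n : ℕ) (X : CompletedTensorAlgebra V) : comp n (-X) = -comp n X :=
  map_neg (compLin V n) X

@[simp]
theorem comp_smul (n : ℕ) (c : ℚ) (X : CompletedTensorAlgebra V) :
    comp n (c • X) = c • comp n X :=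
  map_smul (compLin V n) c X

theorem comp_sum {ι : Type*} (n : ℕ) (s : Finset ι) (X : ι → CompletedTensorAlgebra V) :
    comp n (∑ i ∈ s, X i) = ∑ i ∈ s, comp n (X i) :=
  map_sum (compLin V n) X s

theorem comp_mul (n : ℕ) (X Y : CompletedTensorAlgebra V) :
    comp n (X * Y) = ∑ p ∈ Finset.HasAntidiagonal.antidiagonal n, comp p.1 X * comp p.2 Y :=
  PowerSeries.coeff_mul n _ _

theorem comp_one (n : ℕ) : comp n (1 : CompletedTensorAlgebra V) = if n = 0 then 1 else 0 :=
  PowerSeries.coeff_one n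

@[simp]
theorem comp_zero_one : comp 0 (1 : CompletedTensorAlgebra V) = 1 := by simp [comp_one]

theorem comp_zero_mul (X Y : CompletedTensorAlgebra V) :
    comp 0 (X * Y) = comp 0 X * comp 0 Y := by
  simp [comp_mul]

theorem comp_one_mul (X Y : CompletedTensorAlgebra V) :
    comp 1 (X * Y) = comp 0 X * comp 1 Y + comp 1 X * comp 0 Y := by
  rw [comp_mul, Finset.Nat.antidiagonal_succ]
  simp

variable (V) in
/-- The elements whose components of degree less than `N` vanish. -/
def lowOrder (N : ℕ) : Submodule ℚ (CompletedTensorAlgebra V) where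
  carrier := {X | ∀ n < N, comp n X = 0}
  add_mem' hX hY n hn := by rw [comp_add, hX n hn, hY n hn, add_zero]
  zero_mem' n _ := comp_zero n
  smul_mem' c X hX n hn := by rw [comp_smul, hX n hn, smul_zero]

theorem lowOrder_anti {M N : ℕ} (h : M ≤ N) : lowOrder V N ≤ lowOrder V M :=
  fun _ hX n hn => hX n (hn.trans_le h)

theorem mem_lowOrder_zero (X : CompletedTensorAlgebra V) : X ∈ lowOrder V 0 :=
  fun _ hn => absurd hn (Nat.not_lt_zero _)

theorem mem_lowOrder_one {X : CompletedTensorAlgebra V} :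
    X ∈ lowOrder V 1 ↔ comp 0 X = 0 :=
  ⟨fun h => h 0 zero_lt_one, fun h n hn => by rwa [Nat.lt_one_iff.mp hn]⟩

theorem mul_mem_lowOrder {M N : ℕ} {X Y : CompletedTensorAlgebra V} (hX : X ∈ lowOrder V M)
    (hY : Y ∈ lowOrder V N) : X * Y ∈ lowOrder V (M + N) := by
  intro n hn
  rw [comp_mul]
  refine Finset.sum_eq_zero fun p hp => ?_
  rw [Finset.HasAntidiagonal.mem_antidiagonal] at hp
  rcases lt_or_ge p.1 M with h | h
  · rw [hX _ h, zero_mul]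
  · rw [hY _ (by omega), mul_zero]

theorem mul_mem_lowOrder_left {N : ℕ} {X : CompletedTensorAlgebra V} (hX : X ∈ lowOrder V N)
    (Y : CompletedTensorAlgebra V) : X * Y ∈ lowOrder V N :=
  mul_mem_lowOrder hX (mem_lowOrder_zero Y)

theorem mul_mem_lowOrder_right {N : ℕ} {Y : CompletedTensorAlgebra V} (hY : Y ∈ lowOrder V N)
    (X : CompletedTensorAlgebra V) : X * Y ∈ lowOrder V N := by
  simpa using mul_mem_lowOrder (mem_lowOrder_zero X) hY

theorem pow_mem_lowOrder {X : CompletedTensorAlgebra V} (hX : X ∈ lowOrder V 1) (k : ℕ) :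
    X ^ k ∈ lowOrder V k := by
  induction k with
  | zero => exact mem_lowOrder_zero _
  | succ k ih => rw [pow_succ]; exact mul_mem_lowOrder ih hX

theorem comp_eq_of_sub_mem {N n : ℕ} {X Y : CompletedTensorAlgebra V}
    (h : X - Y ∈ lowOrder V N) (hn : n < N) : comp n X = comp n Y := by
  have := h n hn
  rwa [comp_sub, sub_eq_zero] at this

end Components

/-! ### Infinite sums that converge in the degree filtration. -/

section Sums

variable {V : Type*} [AddCommGroup V] [Module ℚ V]

/-- The sum of a sequence whose `k`-th term has no component of degree less than `k`. -/
noncomputable def sumT (a : ℕ → CompletedTensorAlgebra V) : CompletedTensorAlgebra V :=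
  ofComp (fun n => ∑ k ∈ Finset.range (n + 1), comp n (a k)) fun n =>
    Submodule.sum_mem _ fun k _ => comp_mem n (a k)

theorem comp_sumT_of_lt {a : ℕ → CompletedTensorAlgebra V} (ha : ∀ k, a k ∈ lowOrder V k)
    {n N : ℕ} (h : n < N) : comp n (sumT a) = ∑ k ∈ Finset.range N, comp n (a k) := by
  rw [sumT, comp_ofComp]
  refine Finset.sum_subset (Finset.range_mono h) fun k _ hk => ha k n ?_
  simpa using hk

theorem sumT_sub_sum_mem {a : ℕ → CompletedTensorAlgebra V} (ha : ∀ k, a k ∈ lowOrder V k)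
    (N : ℕ) : sumT a - ∑ k ∈ Finset.range N, a k ∈ lowOrder V N := by
  intro n hn
  rw [comp_sub, comp_sumT_of_lt ha hn, comp_sum, sub_self]

theorem sumT_eq_head_add {a : ℕ → CompletedTensorAlgebra V} (ha : ∀ k, a k ∈ lowOrder V k) :
    sumT a = a 0 + sumT fun k => a (k + 1) := by
  have ha' : ∀ k, a (k + 1) ∈ lowOrder V k := fun k => lowOrder_anti (Nat.le_succ k) (ha _)
  refine ext_comp fun n => ?_
  rw [comp_add, comp_sumT_of_lt ha (show n < n + 1 + 1 by omega),
    comp_sumT_of_lt ha' (Nat.lt_succ_self n), Finset.sum_range_succ', add_comm]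

theorem sumT_mul {a b : ℕ → CompletedTensorAlgebra V} (ha : ∀ k, a k ∈ lowOrder V k)
    (hb : ∀ k, b k ∈ lowOrder V k) :
    sumT a * sumT b = sumT fun n => ∑ p ∈ Finset.HasAntidiagonal.antidiagonal n, a p.1 * b p.2 := by
  have hc : ∀ n, ∑ p ∈ Finset.HasAntidiagonal.antidiagonal n, a p.1 * b p.2 ∈ lowOrder V n :=
    fun n => Submodule.sum_mem _ fun p hp => by
      rw [← Finset.HasAntidiagonal.mem_antidiagonal.mp hp]
      exact mul_mem_lowOrder (ha _) (hb _)
  refine ext_comp fun n => ?_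
  -- Truncating both series after index n alters the product only above degree n.
  have h1 : sumT a * sumT b - (∑ k ∈ Finset.range (n + 1), a k) * ∑ k ∈ Finset.range (n + 1), b k
      ∈ lowOrder V (n + 1) := by
    have e : sumT a * sumT b - (∑ k ∈ Finset.range (n + 1), a k) *
        ∑ k ∈ Finset.range (n + 1), b k =
        (sumT a - ∑ k ∈ Finset.range (n + 1), a k) * sumT b +
        (∑ k ∈ Finset.range (n + 1), a k) * (sumT b - ∑ k ∈ Finset.range (n + 1), b k) := by
      simp only [mul_sub, sub_mul]
      abel
    rw [e]
    exact Submodule.add_mem _ (mul_mem_lowOrder_left (sumT_sub_sum_mem ha _) _)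
      (mul_mem_lowOrder_right (sumT_sub_sum_mem hb _) _)
  rw [comp_eq_of_sub_mem h1 n.lt_succ_self, comp_sumT_of_lt hc n.lt_succ_self,
    Finset.sum_mul_sum, comp_sum]
  simp_rw [comp_sum, Finset.sum_sigma']
  -- A term `a k * b l` with k + l > n has no component of degree n, so the square of index pairs
  -- reduces to the triangle swept out by the antidiagonals.
  rw [← Finset.sum_subset (s₁ := (Finset.range (n + 1)).sigma fun k => Finset.range (n + 1 - k))]
  · refine Finset.sum_nbij' (fun x => ⟨x.1 + x.2, (x.1, x.2)⟩) (fun x => ⟨x.2.1, x.2.2⟩)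
      ?_ ?_ ?_ ?_ ?_
    · simp only [Finset.mem_sigma, Finset.mem_range, Finset.HasAntidiagonal.mem_antidiagonal]
      intro x hx; exact ⟨by omega, trivial⟩
    · simp only [Finset.mem_sigma, Finset.mem_range, Finset.HasAntidiagonal.mem_antidiagonal]
      intro x hx; omega
    · intro x _; rfl
    · rintro ⟨m, p, q⟩ hx
      simp only [Finset.mem_sigma, Finset.mem_range, Finset.HasAntidiagonal.mem_antidiagonal] at hx
      obtain ⟨-, rfl⟩ := hx
      rfl
    · intro x _; rfl
  · intro x
    simp only [Finset.mem_sigma, Finset.mem_range]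
    omega
  · intro x hx hx'
    simp only [Finset.mem_sigma, Finset.mem_range] at hx hx'
    exact mul_mem_lowOrder (ha _) (hb _) n (by omega)

theorem sumT_mul_right {a : ℕ → CompletedTensorAlgebra V} (ha : ∀ k, a k ∈ lowOrder V k)
    (X : CompletedTensorAlgebra V) : sumT a * X = sumT fun k => a k * X := by
  refine ext_comp fun n => ?_
  rw [comp_sumT_of_lt (fun k => mul_mem_lowOrder_left (ha k) X) n.lt_succ_self, ← comp_sum,
    ← Finset.sum_mul]
  refine comp_eq_of_sub_mem (N := n + 1) ?_ n.lt_succ_self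
  rw [← sub_mul]
  exact mul_mem_lowOrder_left (sumT_sub_sum_mem ha _) X

end Sums

/-! ### Evaluation of power series at elements without constant term. -/

section Series

variable {V : Type*} [AddCommGroup V] [Module ℚ V]

theorem evalSeries_eq_sumT (c : ℕ → ℚ) (X : CompletedTensorAlgebra V) :
    evalSeries c X = sumT fun k => c k • X ^ k := by
  refine ext_comp fun n => ?_
  simp [evalSeries, sumT]

theorem smul_pow_mem_lowOrder {X : CompletedTensorAlgebra V} (hX : X ∈ lowOrder V 1) (c : ℕ → ℚ)
    (k : ℕ) : c k • X ^ k ∈ lowOrder V k :=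
  Submodule.smul_mem _ _ (pow_mem_lowOrder hX k)

/-- The value of a formal power series at an element. -/
noncomputable def ev (X : CompletedTensorAlgebra V) (f : PowerSeries ℚ) :
    CompletedTensorAlgebra V :=
  evalSeries (fun k => PowerSeries.coeff k f) X

theorem comp_ev {X : CompletedTensorAlgebra V} (hX : X ∈ lowOrder V 1) (f : PowerSeries ℚ)
    {n N : ℕ} (h : n < N) :
    comp n (ev X f) = ∑ k ∈ Finset.range N, PowerSeries.coeff k f • comp n (X ^ k) := by
  rw [ev, evalSeries_eq_sumT, comp_sumT_of_lt (smul_pow_mem_lowOrder hX _) h]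
  simp

theorem ev_mul {X : CompletedTensorAlgebra V} (hX : X ∈ lowOrder V 1) (f g : PowerSeries ℚ) :
    ev X (f * g) = ev X f * ev X g := by
  simp only [ev, evalSeries_eq_sumT]
  rw [sumT_mul (smul_pow_mem_lowOrder hX _) (smul_pow_mem_lowOrder hX _)]
  congr 1
  funext n
  rw [PowerSeries.coeff_mul, Finset.sum_smul]
  refine Finset.sum_congr rfl fun p hp => ?_
  rw [smul_mul_smul_comm, ← pow_add, Finset.HasAntidiagonal.mem_antidiagonal.mp hp]

theorem ev_one (X : CompletedTensorAlgebra V) : ev X 1 = 1 := by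
  refine ext_comp fun n => ?_
  rw [ev, evalSeries, comp_ofComp, Finset.sum_eq_single 0]
  · simp
  · intro k _ hk
    simp [PowerSeries.coeff_one, hk]
  · simp

theorem ev_pow {X : CompletedTensorAlgebra V} (hX : X ∈ lowOrder V 1) (f : PowerSeries ℚ)
    (k : ℕ) : ev X (f ^ k) = ev X f ^ k := by
  induction k with
  | zero => rw [pow_zero, pow_zero, ev_one]
  | succ k ih => rw [pow_succ, pow_succ, ev_mul hX, ih]

theorem ev_add (X : CompletedTensorAlgebra V) (f g : PowerSeries ℚ) :
    ev X (f + g) = ev X f + ev X g := by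
  refine ext_comp fun n => ?_
  simp [ev, evalSeries, add_smul, Finset.sum_add_distrib]

theorem ev_X {X : CompletedTensorAlgebra V} (hX : X ∈ lowOrder V 1) :
    ev X PowerSeries.X = X := by
  refine ext_comp fun n => ?_
  rw [comp_ev hX _ (show n < n + 2 by omega), Finset.sum_eq_single 1]
  · simp
  · intro k _ hk
    simp [PowerSeries.coeff_X, hk]
  · simp

theorem comp_zero_ev (X : CompletedTensorAlgebra V) (f : PowerSeries ℚ) :
    comp 0 (ev X f) = algebraMap ℚ _ (PowerSeries.constantCoeff f) := by
  simp [ev, evalSeries, Algebra.algebraMap_eq_smul_one]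

theorem ev_mem_lowOrder {X : CompletedTensorAlgebra V} {f : PowerSeries ℚ}
    (hf : PowerSeries.constantCoeff f = 0) : ev X f ∈ lowOrder V 1 := by
  rw [mem_lowOrder_one, comp_zero_ev, hf, map_zero]

/-- In degree n both sides are the same finite double sum: `f ^ d` has order at least d, so cutting
off at n loses nothing. -/
theorem ev_subst {X : CompletedTensorAlgebra V} (hX : X ∈ lowOrder V 1) {f : PowerSeries ℚ}
    (hf : PowerSeries.constantCoeff f = 0) (g : PowerSeries ℚ) :
    ev X (g.subst f) = ev (ev X f) g := by
  refine ext_comp fun n => ?_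
  rw [comp_ev hX _ n.lt_succ_self, comp_ev (ev_mem_lowOrder hf) _ n.lt_succ_self]
  have hs : ∀ k ∈ Finset.range (n + 1), PowerSeries.coeff k (g.subst f) =
      ∑ d ∈ Finset.range (n + 1), PowerSeries.coeff d g * PowerSeries.coeff k (f ^ d) := by
    intro k hk
    rw [PowerSeries.coeff_subst' (PowerSeries.HasSubst.of_constantCoeff_zero' hf)]
    refine finsum_eq_sum_of_support_subset _ fun d hd => ?_
    simp only [Finset.coe_range, Set.mem_Iio]
    by_contra h
    refine hd ?_
    have : PowerSeries.coeff k (f ^ d) = 0 := by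
      refine PowerSeries.coeff_of_lt_order k (lt_of_lt_of_le ?_
        (PowerSeries.le_order_pow_of_constantCoeff_eq_zero d hf))
      exact_mod_cast (by simp at hk; omega : k < d)
    simp [this]
  rw [Finset.sum_congr rfl fun k hk => by rw [hs k hk, Finset.sum_smul], Finset.sum_comm]
  refine Finset.sum_congr rfl fun d _ => ?_
  rw [← ev_pow hX, comp_ev hX _ n.lt_succ_self, Finset.smul_sum]
  simp_rw [mul_smul]

/-- The first order variation of a power series. -/
theorem ev_add_sub_mem {n : ℕ} (hn : 1 ≤ n) {X a : CompletedTensorAlgebra V}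
    (hX : X ∈ lowOrder V 1) (ha : a ∈ lowOrder V n) (f : PowerSeries ℚ) :
    ev (X + a) f - (ev X f + PowerSeries.coeff 1 f • a) ∈ lowOrder V (n + 1) := by
  have hXa : X + a ∈ lowOrder V 1 := Submodule.add_mem _ hX (lowOrder_anti hn ha)
  have hpow : ∀ k, (X + a) ^ (k + 1) - X ^ (k + 1) ∈ lowOrder V n := by
    intro k
    induction k with
    | zero => simpa using ha
    | succ k ih =>
      have e : (X + a) ^ (k + 1 + 1) - X ^ (k + 1 + 1) =
          ((X + a) ^ (k + 1) - X ^ (k + 1)) * (X + a) + X ^ (k + 1) * a := by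
        rw [pow_succ (X + a) (k + 1), pow_succ X (k + 1), sub_mul, mul_add (X ^ (k + 1))]; abel
      rw [e]
      exact Submodule.add_mem _ (mul_mem_lowOrder_left ih _) (mul_mem_lowOrder_right ha _)
  -- In powers of exponent at least two, the factor `a` always comes with another factor of positive
  -- order. Only the linear coefficient of `f` is thus visible in degree n.
  have hpow2 : ∀ k, (X + a) ^ (k + 2) - X ^ (k + 2) ∈ lowOrder V (n + 1) := by
    intro k
    have e : (X + a) ^ (k + 2) - X ^ (k + 2) =
        ((X + a) ^ (k + 1) - X ^ (k + 1)) * (X + a) + X ^ (k + 1) * a := by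
      rw [pow_succ (X + a) (k + 1), pow_succ X (k + 1), sub_mul, mul_add (X ^ (k + 1))]; abel
    rw [e]
    refine Submodule.add_mem _ (mul_mem_lowOrder (hpow k) hXa) ?_
    rw [add_comm]
    exact mul_mem_lowOrder (lowOrder_anti (by omega) (pow_mem_lowOrder hX (k + 1))) ha
  intro m hm
  rw [comp_sub, comp_add, comp_ev hXa _ (show m < m + 2 by omega),
    comp_ev hX _ (show m < m + 2 by omega), comp_smul, ← sub_sub, ← Finset.sum_sub_distrib,
    Finset.sum_range_succ', Finset.sum_range_succ', Finset.sum_eq_zero]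
  · simp
  · intro k _
    rw [← smul_sub, ← comp_sub, hpow2 k m hm, smul_zero]

end Series

/-! ### Exponential, logarithm and the Hausdorff series. -/

section ExpLog

variable {V : Type*} [AddCommGroup V] [Module ℚ V]

theorem expT_eq_ev (X : CompletedTensorAlgebra V) : expT X = ev X (PowerSeries.exp ℚ) := by
  rw [expT, ev]
  congr 1
  funext k
  simp [PowerSeries.coeff_exp]

theorem logT_eq_ev (U : CompletedTensorAlgebra V) : logT U = ev (U - 1) (PowerSeries.log ℚ) := by
  rw [logT, ev]
  congr 1
  funext k
  simp [PowerSeries.coeff_log]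

/-- The composite q solves q' (1 + X) = q with q(0) = 1, that is (n + 1) q_{n+1} = (1 - n) q_n. The
factor 1 - n kills every coefficient from degree two on. -/
theorem exp_subst_log : (PowerSeries.exp ℚ).subst (PowerSeries.log ℚ) = 1 + PowerSeries.X := by
  have hs : PowerSeries.HasSubst (PowerSeries.log ℚ) := PowerSeries.HasSubst.log
  set q := (PowerSeries.exp ℚ).subst (PowerSeries.log ℚ) with hq
  have hd : PowerSeries.derivative ℚ q * (1 + PowerSeries.X) = q := by
    have hl : PowerSeries.derivative ℚ (PowerSeries.log ℚ) * (1 + PowerSeries.X) = 1 := by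
      rw [PowerSeries.deriv_log]
      ext n
      cases n with
      | zero => simp
      | succ n =>
        rw [mul_add, mul_one, map_add, PowerSeries.coeff_succ_mul_X]
        simp [PowerSeries.coeff_one, pow_succ]
    rw [hq, PowerSeries.derivative_subst hs, mul_assoc, hl, mul_one, PowerSeries.derivative_exp]
  have h0 : PowerSeries.coeff 0 q = 1 := by
    rw [hq, PowerSeries.coeff_subst' hs, finsum_eq_single _ 0]
    · simp
    · intro d hd
      simp [hd]
  have hrec : ∀ n : ℕ, PowerSeries.coeff (n + 1) q * (n + 1) =
      PowerSeries.coeff n q - PowerSeries.coeff n q * n := by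
    intro n
    have := congrArg (PowerSeries.coeff n) hd
    rw [mul_add, mul_one, map_add, PowerSeries.coeff_derivative] at this
    cases n with
    | zero => simp at this ⊢; linarith
    | succ n =>
      rw [PowerSeries.coeff_succ_mul_X, PowerSeries.coeff_derivative] at this
      push_cast at this ⊢
      linarith
  have h1 : PowerSeries.coeff 1 q = 1 := by
    have := hrec 0
    simp only [h0] at this
    simpa using this
  have h2 : ∀ n, PowerSeries.coeff (n + 2) q = 0 := by
    intro n
    induction n with
    | zero =>
      have := hrec 1
      rw [h1] at this
      norm_num at this
      exact this
    | succ n ih =>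
      have := hrec (n + 2)
      rw [ih] at this
      have hne : ((n + 2 : ℕ) : ℚ) + 1 ≠ 0 := by positivity
      rw [zero_mul, sub_zero] at this
      exact (mul_eq_zero.mp this).resolve_right hne
  ext n
  match n with
  | 0 => rw [h0]; simp
  | 1 => rw [h1]; simp [PowerSeries.coeff_one]
  | n + 2 => rw [h2]; simp [PowerSeries.coeff_one, PowerSeries.coeff_X]

theorem comp_zero_expT (X : CompletedTensorAlgebra V) : comp 0 (expT X) = 1 := by
  simp [expT_eq_ev, comp_zero_ev]

theorem comp_zero_logT (U : CompletedTensorAlgebra V) : comp 0 (logT U) = 0 := by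
  simp [logT_eq_ev, comp_zero_ev]

theorem expT_logT {U : CompletedTensorAlgebra V} (hU : comp 0 U = 1) : expT (logT U) = U := by
  have h : U - 1 ∈ lowOrder V 1 := by simp [mem_lowOrder_one, hU]
  rw [expT_eq_ev, logT_eq_ev, ← ev_subst h PowerSeries.constantCoeff_log, exp_subst_log, ev_add,
    ev_one, ev_X h]
  abel

theorem expT_zero : expT (0 : CompletedTensorAlgebra V) = 1 := by
  refine ext_comp fun n => ?_
  rw [expT_eq_ev, ev, evalSeries, comp_ofComp, Finset.sum_eq_single 0]
  · simp
  · intro k _ hk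
    simp [hk]
  · simp

theorem ev_neg (X : CompletedTensorAlgebra V) (f : PowerSeries ℚ) :
    ev (-X) f = ev X (PowerSeries.evalNegHom f) := by
  refine ext_comp fun n => ?_
  simp only [ev, evalSeries, comp_ofComp]
  refine Finset.sum_congr rfl fun k _ => ?_
  rw [PowerSeries.evalNegHom, PowerSeries.coeff_rescale, ← neg_one_smul ℚ X, smul_pow, comp_smul,
    smul_smul, mul_comm]

theorem expT_mul_expT_neg {X : CompletedTensorAlgebra V} (hX : comp 0 X = 0) :
    expT X * expT (-X) = 1 := by
  have h := mem_lowOrder_one.mpr hX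
  rw [expT_eq_ev, expT_eq_ev, ev_neg, ← ev_mul h, PowerSeries.exp_mul_exp_neg_eq_one, ev_one]

theorem expT_neg_mul_expT {X : CompletedTensorAlgebra V} (hX : comp 0 X = 0) :
    expT (-X) * expT X = 1 := by
  simpa using expT_mul_expT_neg (X := -X) (by simp [hX])

theorem expT_add_sub_mem {n : ℕ} (hn : 1 ≤ n) {X a : CompletedTensorAlgebra V}
    (hX : comp 0 X = 0) (ha : a ∈ lowOrder V n) :
    expT (X + a) - (expT X + a) ∈ lowOrder V (n + 1) := by
  have := ev_add_sub_mem hn (mem_lowOrder_one.mpr hX) ha (PowerSeries.exp ℚ)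
  rw [expT_eq_ev, expT_eq_ev]
  simpa using this

theorem comp_one_expT {X : CompletedTensorAlgebra V} (hX : comp 0 X = 0) :
    comp 1 (expT X) = comp 1 X := by
  have := expT_add_sub_mem le_rfl (comp_zero 0) (mem_lowOrder_one.mpr hX)
  rw [zero_add, expT_zero] at this
  rw [comp_eq_of_sub_mem this one_lt_two, comp_add]
  simp [comp_one]

/-- If X - Y has order N ≥ 1, then exp X - exp Y agrees with it modulo order N + 1, so the order can
be raised one degree at a time. Injectivity of `expT` follows without the identity log (exp X) = X.
-/
theorem sub_mem_of_expT_sub_mem {N : ℕ} {X Y : CompletedTensorAlgebra V} (hX : comp 0 X = 0)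
    (hY : comp 0 Y = 0) (h : expT X - expT Y ∈ lowOrder V N) : X - Y ∈ lowOrder V N := by
  induction N with
  | zero => exact mem_lowOrder_zero _
  | succ N ih =>
    have h1 := ih (lowOrder_anti N.le_succ h)
    rcases Nat.eq_zero_or_pos N with rfl | hN
    · rw [mem_lowOrder_one, comp_sub, hX, hY, sub_zero]
    · have h2 := expT_add_sub_mem hN hY h1
      rw [add_sub_cancel] at h2
      have := Submodule.sub_mem _ h h2
      convert this using 1
      abel

theorem expT_injective {X Y : CompletedTensorAlgebra V} (hX : comp 0 X = 0)
    (hY : comp 0 Y = 0) (h : expT X = expT Y) : X = Y := by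
  refine ext_comp fun n => comp_eq_of_sub_mem (N := n + 1) ?_ n.lt_succ_self
  exact sub_mem_of_expT_sub_mem hX hY (by rw [h, sub_self]; exact Submodule.zero_mem _)

theorem hausdorff_spec (X Y : CompletedTensorAlgebra V) :
    expT (X + Y + hausdorff X Y) = expT X * expT Y := by
  have e : X + Y + hausdorff X Y = logT (expT X * expT Y) := by
    rw [hausdorff]; abel
  rw [e, expT_logT]
  rw [comp_zero_mul, comp_zero_expT, comp_zero_expT, one_mul]

theorem comp_zero_hausdorff {X Y : CompletedTensorAlgebra V} (hX : comp 0 X = 0)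
    (hY : comp 0 Y = 0) : comp 0 (hausdorff X Y) = 0 := by
  simp [hausdorff, comp_zero_logT, hX, hY]

/-- The component of degree `n` of `h(X, Y)` depends only on the components of `X` and `Y` of
degree less than `n`. -/
theorem hausdorff_sub_mem {n : ℕ} (hn : 1 ≤ n) {X X' Y Y' : CompletedTensorAlgebra V}
    (hX : comp 0 X = 0) (hY : comp 0 Y = 0) (hXX : X' - X ∈ lowOrder V n)
    (hYY : Y' - Y ∈ lowOrder V n) : hausdorff X' Y' - hausdorff X Y ∈ lowOrder V (n + 1) := by
  obtain ⟨a, rfl⟩ : ∃ a, X' = X + a := ⟨X' - X, by abel⟩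
  obtain ⟨b, rfl⟩ : ∃ b, Y' = Y + b := ⟨Y' - Y, by abel⟩
  rw [add_sub_cancel_left] at hXX hYY
  have ha := expT_add_sub_mem hn hX hXX
  have hb := expT_add_sub_mem hn hY hYY
  have ha0 : comp 0 a = 0 := hXX 0 hn
  have hb0 : comp 0 b = 0 := hYY 0 hn
  have hZ : comp 0 (X + Y + hausdorff X Y) = 0 := by
    simp [hX, hY, comp_zero_hausdorff]
  -- Perturbing X by a and Y by b changes exp X exp Y by a + b modulo order n + 1. Adding a + b to
  -- the logarithm has the same effect, so h itself does not move.
  have key : expT (X + a + (Y + b) + hausdorff (X + a) (Y + b)) -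
      expT (X + Y + hausdorff X Y + (a + b)) ∈ lowOrder V (n + 1) := by
    have hc := expT_add_sub_mem hn hZ (Submodule.add_mem _ hXX hYY)
    have e1 : expT X - 1 ∈ lowOrder V 1 := by
      simp [mem_lowOrder_one, comp_zero_expT]
    have e2 : expT Y - 1 ∈ lowOrder V 1 := by
      simp [mem_lowOrder_one, comp_zero_expT]
    rw [hausdorff_spec] at hc ⊢
    have m1 := mul_mem_lowOrder_left ha (expT (Y + b))
    have m2 := mul_mem_lowOrder_right hb (expT X + a)
    have m3 := mul_mem_lowOrder e1 hYY
    have m4 := mul_mem_lowOrder hXX e2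
    have m5 : a * b ∈ lowOrder V (n + 1) :=
      lowOrder_anti (by omega) (mul_mem_lowOrder hXX hYY)
    rw [add_comm 1 n] at m3
    convert Submodule.sub_mem _ (Submodule.add_mem _ (Submodule.add_mem _ (Submodule.add_mem _
      (Submodule.add_mem _ m1 m2) m3) m4) m5) hc using 1
    simp only [mul_add, add_mul, mul_sub, sub_mul, one_mul, mul_one]
    abel
  have := sub_mem_of_expT_sub_mem ?_ ?_ key
  · convert this using 1
    abel
  · simp [hX, hY, ha0, hb0, comp_zero_hausdorff]
  · simp [hX, hY, ha0, hb0, comp_zero_hausdorff]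

theorem hausdorff_zero : hausdorff (0 : CompletedTensorAlgebra V) 0 = 0 := by
  refine expT_injective (comp_zero_hausdorff (comp_zero 0) (comp_zero 0)) (comp_zero 0) ?_
  have := hausdorff_spec (0 : CompletedTensorAlgebra V) 0
  rwa [zero_add, zero_add, expT_zero, one_mul, ← expT_zero] at this

theorem comp_one_hausdorff {X Y : CompletedTensorAlgebra V} (hX : comp 0 X = 0)
    (hY : comp 0 Y = 0) : comp 1 (hausdorff X Y) = 0 := by
  have := hausdorff_sub_mem (n := 1) le_rfl (comp_zero 0) (comp_zero 0)
    (by rw [sub_zero]; exact mem_lowOrder_one.mpr hX)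
    (by rw [sub_zero]; exact mem_lowOrder_one.mpr hY)
  rw [hausdorff_zero, sub_zero] at this
  exact this 1 one_lt_two

end ExpLog

/-! ### Naturality under linear maps. -/

section Naturality

variable {V W : Type*} [AddCommGroup V] [Module ℚ V] [AddCommGroup W] [Module ℚ W]

@[simp]
theorem comp_completedTensorMap (f : V →ₗ[ℚ] W) (n : ℕ) (X : CompletedTensorAlgebra V) :
    comp n (completedTensorMap f X) = tensorMap f (comp n X) :=
  comp_ofComp _ _ _

/-- The map induced by a linear map on completed tensor algebras is an algebra homomorphism. -/
noncomputable def completedTensorHom (f : V →ₗ[ℚ] W) :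
    CompletedTensorAlgebra V →ₐ[ℚ] CompletedTensorAlgebra W :=
  AlgHom.ofLinearMap
    { toFun := completedTensorMap f
      map_add' := fun X Y => ext_comp fun n => by simp
      map_smul' := fun c X => ext_comp fun n => by simp }
    (ext_comp fun n => by
      change comp n (completedTensorMap f 1) = _
      rw [comp_completedTensorMap, comp_one, comp_one]; split_ifs <;> simp)
    (fun X Y => ext_comp fun n => by
      change comp n (completedTensorMap f (X * Y)) =
        comp n (completedTensorMap f X * completedTensorMap f Y)
      rw [comp_completedTensorMap, comp_mul, comp_mul, map_sum]
      simp)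

theorem completedTensorHom_apply (f : V →ₗ[ℚ] W) (X : CompletedTensorAlgebra V) :
    completedTensorHom f X = completedTensorMap f X := rfl

theorem completedTensorHom_evalSeries (f : V →ₗ[ℚ] W) (c : ℕ → ℚ)
    (X : CompletedTensorAlgebra V) :
    completedTensorHom f (evalSeries c X) = evalSeries c (completedTensorHom f X) := by
  refine ext_comp fun n => ?_
  rw [completedTensorHom_apply, comp_completedTensorMap]
  simp only [evalSeries, comp_ofComp, map_sum, map_smul, ← map_pow]
  simp only [completedTensorHom_apply, comp_completedTensorMap]

theorem completedTensorHom_expT (f : V →ₗ[ℚ] W) (X : CompletedTensorAlgebra V) :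
    completedTensorHom f (expT X) = expT (completedTensorHom f X) :=
  completedTensorHom_evalSeries f _ X

theorem completedTensorHom_hausdorff (f : V →ₗ[ℚ] W) (X Y : CompletedTensorAlgebra V) :
    completedTensorHom f (hausdorff X Y) =
      hausdorff (completedTensorHom f X) (completedTensorHom f Y) := by
  rw [hausdorff, hausdorff, map_sub, map_sub, logT, logT, completedTensorHom_evalSeries, map_sub,
    map_mul, map_one, completedTensorHom_expT, completedTensorHom_expT]

end Naturality

/-! ### Conjugation by an exponential as a series of iterated brackets. -/

section Conjugation

variable {R : Type*} [Ring R]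

/-- The operator `W ↦ [W, Y]`. -/
def adRight (Y W : R) : R := W * Y - Y * W

variable [Algebra ℚ R]

/-- Left multiplication by -Y and right multiplication by Y commute, so writing the bracket as their
sum makes its powers accessible to the binomial theorem. -/
theorem iterate_adRight (Y W : R) (n : ℕ) :
    (adRight Y)^[n] W =
      ((LinearMap.mulLeft ℚ (-Y) + LinearMap.mulRight ℚ Y) ^ n : Module.End ℚ R) W := by
  rw [Module.End.pow_apply]
  congr 2
  funext X
  simp only [adRight, LinearMap.add_apply, LinearMap.mulLeft_apply, LinearMap.mulRight_apply]
  noncomm_ring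

/-- The terms of degree `n` in `Y` of `exp (-Y) W exp Y`. -/
theorem sum_antidiagonal_conj (Y W : R) (n : ℕ) :
    ∑ p ∈ Finset.HasAntidiagonal.antidiagonal n,
      ((1 / (p.1.factorial : ℚ)) • (-Y) ^ p.1) * W * ((1 / (p.2.factorial : ℚ)) • Y ^ p.2) =
      (1 / (n.factorial : ℚ)) • (adRight Y)^[n] W := by
  have hc : Commute (LinearMap.mulLeft ℚ (-Y)) (LinearMap.mulRight ℚ Y) :=
    LinearMap.commute_mulLeft_right (-Y) Y
  rw [iterate_adRight, hc.add_pow', LinearMap.sum_apply,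
    Finset.smul_sum]
  refine Finset.sum_congr rfl fun p hp => ?_
  rw [Finset.HasAntidiagonal.mem_antidiagonal] at hp
  rw [LinearMap.pow_mulLeft, LinearMap.pow_mulRight, LinearMap.smul_apply, Module.End.mul_apply,
    LinearMap.mulLeft_apply, LinearMap.mulRight_apply, ← Nat.cast_smul_eq_nsmul ℚ, smul_smul,
    smul_mul_assoc, smul_mul_assoc, mul_smul_comm, smul_smul, mul_assoc]
  congr 1
  subst hp
  rw [Nat.cast_add_choose]
  have h1 := Nat.factorial_ne_zero p.1
  have h2 := Nat.factorial_ne_zero p.2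
  have h3 := Nat.factorial_ne_zero (p.1 + p.2)
  field_simp

end Conjugation

/-! ### The Euler derivation and the logarithmic derivative of exp. -/

section Euler

variable {V : Type*} [AddCommGroup V] [Module ℚ V]

variable (V) in
/-- The derivation that multiplies the component of degree `n` by `n`. -/
noncomputable def euler : CompletedTensorAlgebra V →ₗ[ℚ] CompletedTensorAlgebra V where
  toFun X := ofComp (fun n => (n : ℚ) • comp n X) fun n => Submodule.smul_mem _ _ (comp_mem n X)
  map_add' X Y := ext_comp fun n => by simp
  map_smul' c X := ext_comp fun n => by simp [smul_smul, mul_comm]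

@[simp]
theorem comp_euler (n : ℕ) (X : CompletedTensorAlgebra V) :
    comp n (euler V X) = (n : ℚ) • comp n X :=
  comp_ofComp n (fun n => (n : ℚ) • comp n X)
    fun n => Submodule.smul_mem _ _ (comp_mem n X)

theorem euler_mul (X Y : CompletedTensorAlgebra V) :
    euler V (X * Y) = euler V X * Y + X * euler V Y := by
  refine ext_comp fun n => ?_
  rw [comp_euler, comp_add, comp_mul, comp_mul, comp_mul, ← Finset.sum_add_distrib,
    Finset.smul_sum]
  refine Finset.sum_congr rfl fun p hp => ?_
  rw [Finset.HasAntidiagonal.mem_antidiagonal] at hp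
  rw [comp_euler, comp_euler, smul_mul_assoc, mul_smul_comm, ← add_smul, ← hp, Nat.cast_add]

theorem euler_one : euler V 1 = 0 := by
  refine ext_comp fun n => ?_
  rw [comp_euler, comp_one]
  split_ifs with h <;> simp [h]

theorem euler_mem_lowOrder {N : ℕ} {X : CompletedTensorAlgebra V} (hX : X ∈ lowOrder V N) :
    euler V X ∈ lowOrder V N := by
  intro n hn
  rw [comp_euler, hX n hn, smul_zero]

theorem euler_sumT (a : ℕ → CompletedTensorAlgebra V) :
    euler V (sumT a) = sumT fun k => euler V (a k) := by
  refine ext_comp fun n => ?_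
  simp [sumT, Finset.smul_sum]

/-- The logarithmic derivative `exp (-X) E (exp X)` of `exp` with respect to the Euler
derivation. -/
noncomputable def logDeriv (X : CompletedTensorAlgebra V) : CompletedTensorAlgebra V :=
  expT (-X) * euler V (expT X)

theorem adRight_mulLeft (Z W : CompletedTensorAlgebra V) :
    adRight (LinearMap.mulLeft ℚ Z : Module.End ℚ (CompletedTensorAlgebra V))
      (LinearMap.mulLeft ℚ W) = LinearMap.mulLeft ℚ (adRight Z W) := by
  ext1 X
  simp only [adRight, LinearMap.sub_apply, Module.End.mul_apply, LinearMap.mulLeft_apply, sub_mul,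
    mul_assoc]

/-- This is the Leibniz rule as a commutator of operators. It lets the conjugation formula be
applied in the endomorphism ring, where the derivation itself is an element. -/
theorem adRight_mulLeft_euler (Z : CompletedTensorAlgebra V) :
    adRight (LinearMap.mulLeft ℚ Z : Module.End ℚ (CompletedTensorAlgebra V)) (euler V) =
      LinearMap.mulLeft ℚ (euler V Z) := by
  ext1 X
  simp only [adRight, LinearMap.sub_apply, Module.End.mul_apply, LinearMap.mulLeft_apply,
    euler_mul, add_sub_cancel_right]

theorem iterate_adRight_mulLeft (Z W : CompletedTensorAlgebra V) (n : ℕ) :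
    (adRight (LinearMap.mulLeft ℚ Z : Module.End ℚ (CompletedTensorAlgebra V)))^[n]
      (LinearMap.mulLeft ℚ W) = LinearMap.mulLeft ℚ ((adRight Z)^[n] W) := by
  induction n with
  | zero => rfl
  | succ n ih => rw [Function.iterate_succ_apply', ih, adRight_mulLeft,
      Function.iterate_succ_apply']

theorem exp_terms_mem {X : CompletedTensorAlgebra V} (hX : comp 0 X = 0) (k : ℕ) :
    (1 / (k.factorial : ℚ)) • X ^ k ∈ lowOrder V k :=
  Submodule.smul_mem _ _ (pow_mem_lowOrder (mem_lowOrder_one.mpr hX) k)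

theorem expT_eq_sumT (X : CompletedTensorAlgebra V) :
    expT X = sumT fun k => (1 / (k.factorial : ℚ)) • X ^ k :=
  evalSeries_eq_sumT _ X

theorem expT_conj {Y : CompletedTensorAlgebra V} (hY : comp 0 Y = 0)
    (W : CompletedTensorAlgebra V) :
    expT (-Y) * W * expT Y = sumT fun n => (1 / (n.factorial : ℚ)) • (adRight Y)^[n] W := by
  have hY' : comp 0 (-Y) = 0 := by simp [hY]
  rw [expT_eq_sumT, expT_eq_sumT, sumT_mul_right (exp_terms_mem hY'),
    sumT_mul (fun k => mul_mem_lowOrder_left (exp_terms_mem hY' k) W) (exp_terms_mem hY)]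
  congr 1
  funext n
  exact sum_antidiagonal_conj Y W n

theorem iterate_adRight_mem {Y W : CompletedTensorAlgebra V} (hY : Y ∈ lowOrder V 1) {m : ℕ}
    (hW : W ∈ lowOrder V m) (n : ℕ) : (adRight Y)^[n] W ∈ lowOrder V (m + n) := by
  induction n with
  | zero => exact hW
  | succ n ih =>
    rw [Function.iterate_succ_apply']
    have h := mul_mem_lowOrder hY ih
    rw [add_comm, add_assoc] at h
    exact Submodule.sub_mem _ (mul_mem_lowOrder (M := m + n) ih hY) h

/-- The left side is the operator E, conjugated by left multiplication by exp Z, evaluated at 1. The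
zeroth term is E(1) = 0 and the first bracket already turns E into multiplication by E(Z), which
shifts n! to (n + 1)!. -/
theorem logDeriv_eq {Z : CompletedTensorAlgebra V} (hZ : comp 0 Z = 0) :
    logDeriv Z =
      sumT fun n => (1 / ((n + 1).factorial : ℚ)) • (adRight Z)^[n] (euler V Z) := by
  have hZ' : comp 0 (-Z) = 0 := by simp [hZ]
  have hZ1 := mem_lowOrder_one.mpr hZ
  have key : logDeriv Z = sumT fun n => (1 / (n.factorial : ℚ)) •
      ((adRight (LinearMap.mulLeft ℚ Z : Module.End ℚ (CompletedTensorAlgebra V)))^[n]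
        (euler V)) 1 := by
    rw [logDeriv, expT_eq_sumT, expT_eq_sumT, euler_sumT,
      sumT_mul (exp_terms_mem hZ') fun k => euler_mem_lowOrder (exp_terms_mem hZ k)]
    congr 1
    funext n
    rw [← LinearMap.smul_apply, ← sum_antidiagonal_conj, LinearMap.sum_apply]
    refine Finset.sum_congr rfl fun p _ => ?_
    rw [Module.End.mul_apply, Module.End.mul_apply, LinearMap.smul_apply, LinearMap.smul_apply,
      LinearMap.pow_mulLeft, LinearMap.mulLeft_apply, mul_one,
      show -LinearMap.mulLeft ℚ Z = LinearMap.mulLeft ℚ (-Z) from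
        LinearMap.ext fun X => (neg_mul Z X).symm,
      LinearMap.pow_mulLeft, LinearMap.mulLeft_apply, smul_mul_assoc]
  have hs : ∀ n, ((adRight (LinearMap.mulLeft ℚ Z :
      Module.End ℚ (CompletedTensorAlgebra V)))^[n + 1] (euler V)) 1 =
      (adRight Z)^[n] (euler V Z) := by
    intro n
    rw [Function.iterate_succ_apply, adRight_mulLeft_euler, iterate_adRight_mulLeft,
      LinearMap.mulLeft_apply, mul_one]
  rw [key, sumT_eq_head_add]
  · simp only [hs]
    simp [euler_one]
  · intro n
    refine Submodule.smul_mem _ _ ?_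
    cases n with
    | zero => exact mem_lowOrder_zero _
    | succ n =>
      rw [hs, add_comm]
      exact iterate_adRight_mem hZ1 (euler_mem_lowOrder hZ1) n

end Euler

/-! ### The Baker–Campbell–Hausdorff theorem. -/

section Lie

variable {V : Type*} [AddCommGroup V] [Module ℚ V]

attribute [local instance] LieRing.ofAssociativeRing in
theorem commutator_mem_freeLie {x y : TensorAlgebra ℚ V} (hx : x ∈ freeLie V)
    (hy : y ∈ freeLie V) : x * y - y * x ∈ freeLie V :=
  (LieSubalgebra.lieSpan ℚ (TensorAlgebra ℚ V)
    (Set.range (TensorAlgebra.ι ℚ : V → TensorAlgebra ℚ V))).lie_mem hx hy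

attribute [local instance] LieRing.ofAssociativeRing in
theorem ι_mem_freeLie (v : V) : TensorAlgebra.ι ℚ v ∈ freeLie V :=
  LieSubalgebra.subset_lieSpan ⟨v, rfl⟩

variable (V) in
/-- The elements without constant term whose components of degree less than `N` lie in the free
Lie algebra. -/
noncomputable def lieBelow (N : ℕ) : Submodule ℚ (CompletedTensorAlgebra V) where
  carrier := {X | comp 0 X = 0 ∧ ∀ n < N, comp n X ∈ freeLie V}
  add_mem' hX hY := ⟨by rw [comp_add, hX.1, hY.1, add_zero], fun n hn => by
    rw [comp_add]; exact Submodule.add_mem _ (hX.2 n hn) (hY.2 n hn)⟩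
  zero_mem' := ⟨comp_zero 0, fun n _ => by rw [comp_zero]; exact Submodule.zero_mem _⟩
  smul_mem' c X hX := ⟨by rw [comp_smul, hX.1, smul_zero], fun n hn => by
    rw [comp_smul]; exact Submodule.smul_mem _ _ (hX.2 n hn)⟩

theorem lieBelow_anti {M N : ℕ} (h : M ≤ N) : lieBelow V N ≤ lieBelow V M :=
  fun _ hX => ⟨hX.1, fun n hn => hX.2 n (hn.trans_le h)⟩

theorem euler_mem_lieBelow {N : ℕ} {X : CompletedTensorAlgebra V} (hX : X ∈ lieBelow V N) :
    euler V X ∈ lieBelow V N :=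
  ⟨by rw [comp_euler, hX.1, smul_zero], fun n hn => by
    rw [comp_euler]; exact Submodule.smul_mem _ _ (hX.2 n hn)⟩

/-- One degree is gained because neither factor has a constant term: the bracket in degree N
involves only components of degree below N. -/
theorem adRight_mem_lieBelow {N : ℕ} {X Y : CompletedTensorAlgebra V} (hX : X ∈ lieBelow V N)
    (hY : Y ∈ lieBelow V N) : adRight Y X ∈ lieBelow V (N + 1) := by
  refine ⟨by simp [adRight, comp_zero_mul, hX.1], fun n hn => ?_⟩
  rw [adRight, comp_sub, comp_mul, comp_mul,
    ← Finset.Nat.sum_antidiagonal_swap (n := n) (f := fun p => comp p.1 Y * comp p.2 X),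
    ← Finset.sum_sub_distrib]
  refine Submodule.sum_mem _ fun p hp => ?_
  rw [Finset.HasAntidiagonal.mem_antidiagonal] at hp
  change comp p.1 X * comp p.2 Y - comp p.2 Y * comp p.1 X ∈ _
  rcases Nat.eq_zero_or_pos p.1 with h | h
  · rw [h, hX.1, zero_mul, mul_zero, sub_zero]; exact Submodule.zero_mem _
  rcases Nat.eq_zero_or_pos p.2 with h' | h'
  · rw [h', hY.1, zero_mul, mul_zero, sub_zero]; exact Submodule.zero_mem _
  exact commutator_mem_freeLie (hX.2 _ (by omega)) (hY.2 _ (by omega))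

theorem iterate_adRight_mem_lieBelow {N : ℕ} {X Y : CompletedTensorAlgebra V}
    (hX : X ∈ lieBelow V N) (hY : Y ∈ lieBelow V N) (k : ℕ) :
    (adRight Y)^[k] X ∈ lieBelow V N := by
  induction k with
  | zero => exact hX
  | succ k ih =>
    rw [Function.iterate_succ_apply']
    exact lieBelow_anti N.le_succ (adRight_mem_lieBelow ih hY)

theorem sumT_mem_lieBelow {N : ℕ} {a : ℕ → CompletedTensorAlgebra V}
    (ha : ∀ k, a k ∈ lieBelow V N) : sumT a ∈ lieBelow V N := by
  refine ⟨?_, fun n hn => ?_⟩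
  · rw [sumT, comp_ofComp]
    exact Finset.sum_eq_zero fun k _ => (ha k).1
  · rw [sumT, comp_ofComp]
    exact Submodule.sum_mem _ fun k _ => (ha k).2 n hn

theorem logDeriv_mem_lieBelow {N : ℕ} {X : CompletedTensorAlgebra V} (hX : X ∈ lieBelow V N) :
    logDeriv X ∈ lieBelow V N := by
  rw [logDeriv_eq hX.1]
  exact sumT_mem_lieBelow fun k =>
    Submodule.smul_mem _ _ (iterate_adRight_mem_lieBelow (euler_mem_lieBelow hX) hX k)

/-- In degree m, `logDeriv Z` is m times the component of Z plus brackets of lower components. As m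
> 0 is invertible in ℚ, membership in the free Lie algebra climbs degree by degree. -/
theorem mem_lieBelow_of_logDeriv_mem {N : ℕ} {Z : CompletedTensorAlgebra V} (hZ : comp 0 Z = 0)
    (h : logDeriv Z ∈ lieBelow V N) : Z ∈ lieBelow V N := by
  suffices ∀ n ≤ N, Z ∈ lieBelow V n from this N le_rfl
  intro n
  induction n with
  | zero => exact fun _ => ⟨hZ, fun n hn => absurd hn (Nat.not_lt_zero _)⟩
  | succ n ih =>
    intro hn
    have ihn := ih (by omega)
    refine ⟨hZ, fun m hm => ?_⟩
    rcases Nat.lt_succ_iff_lt_or_eq.mp hm with hm | rfl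
    · exact ihn.2 m hm
    rcases Nat.eq_zero_or_pos m with rfl | hm0
    · rw [hZ]; exact Submodule.zero_mem _
    have h1 := h.2 m (by omega)
    rw [logDeriv_eq hZ, sumT, comp_ofComp, Finset.sum_range_succ'] at h1
    have h2 : ∑ k ∈ Finset.range m, comp m ((1 / ((k + 1 + 1).factorial : ℚ)) •
        (adRight Z)^[k + 1] (euler V Z)) ∈ freeLie V := by
      refine Submodule.sum_mem _ fun k _ => ?_
      rw [comp_smul, Function.iterate_succ_apply]
      refine Submodule.smul_mem _ _ ?_
      have h3 := adRight_mem_lieBelow (euler_mem_lieBelow ihn) ihn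
      have h4 : ∀ k, (adRight Z)^[k] (adRight Z (euler V Z)) ∈ lieBelow V (m + 1) := by
        intro k
        induction k with
        | zero => exact h3
        | succ k ihk =>
          rw [Function.iterate_succ_apply']
          exact adRight_mem_lieBelow (lieBelow_anti m.le_succ ihk) ihn
      exact (h4 k).2 m m.lt_succ_self
    have h5 := (Submodule.add_mem_iff_right _ h2).mp h1
    rw [comp_smul, Function.iterate_zero_apply, comp_euler, smul_smul] at h5
    exact (Submodule.smul_mem_iff _ (by simp; omega)).mp h5

/-- The Baker–Campbell–Hausdorff theorem. -/
theorem hausdorff_mem_lieBelow {N : ℕ} {X Y : CompletedTensorAlgebra V} (hX : X ∈ lieBelow V N)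
    (hY : Y ∈ lieBelow V N) : hausdorff X Y ∈ lieBelow V N := by
  have hZ0 : comp 0 (X + Y + hausdorff X Y) = 0 := by
    simp [hX.1, hY.1, comp_zero_hausdorff]
  have hneg : expT (-(X + Y + hausdorff X Y)) = expT (-Y) * expT (-X) := by
    have e1 := expT_neg_mul_expT hZ0
    have e2 := expT_mul_expT_neg hX.1
    have e3 := expT_mul_expT_neg hY.1
    rw [hausdorff_spec] at e1
    calc expT (-(X + Y + hausdorff X Y))
        = expT (-(X + Y + hausdorff X Y)) * (expT X * (expT Y * expT (-Y)) * expT (-X)) := by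
          rw [e3, mul_one, e2, mul_one]
      _ = (expT (-(X + Y + hausdorff X Y)) * (expT X * expT Y)) * (expT (-Y) * expT (-X)) := by
          simp only [mul_assoc]
      _ = _ := by rw [e1, one_mul]
  -- By the product rule the logarithmic derivative of exp X exp Y is that of X conjugated by exp Y,
  -- plus that of Y. Conjugation is a series of brackets, so the result stays in the free Lie
  -- algebra.
  have hlog : logDeriv (X + Y + hausdorff X Y) =
      expT (-Y) * logDeriv X * expT Y + logDeriv Y := by
    have e2 := expT_neg_mul_expT hX.1
    rw [logDeriv, hneg, hausdorff_spec, euler_mul, logDeriv, logDeriv, mul_add]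
    congr 1
    · simp only [mul_assoc]
    · rw [mul_assoc, ← mul_assoc (expT (-X)), e2, one_mul]
  have hm : logDeriv (X + Y + hausdorff X Y) ∈ lieBelow V N := by
    rw [hlog, expT_conj hY.1]
    exact Submodule.add_mem _ (sumT_mem_lieBelow fun k => Submodule.smul_mem _ _
      (iterate_adRight_mem_lieBelow (logDeriv_mem_lieBelow hX) hY k)) (logDeriv_mem_lieBelow hY)
  exact (Submodule.add_mem_iff_right _ (Submodule.add_mem _ hX hY)).mp
    (mem_lieBelow_of_logDeriv_mem hZ0 hm)

end Lie

/-! ### Positions along the boundary cycle and telescoping at a vertex. -/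

namespace BorderedFatgraph

section Position

variable (G : BorderedFatgraph.{u})

open Classical in
/-- The number of steps that lead along the boundary cycle from the tail to `x`. -/
noncomputable def position (x : G.E) : ℕ := Nat.find (G.exists_boundary_pow G.tail x)

theorem boundary_pow_position (x : G.E) : (G.boundary ^ G.position x) G.tail = x := by
  classical exact Nat.find_spec (G.exists_boundary_pow G.tail x)

variable {G} in
theorem position_le {x : G.E} {k : ℕ} (h : (G.boundary ^ k) G.tail = x) : G.position x ≤ k := by
  classical exact Nat.find_min' (G.exists_boundary_pow G.tail x) h

theorem position_injective : Function.Injective G.position := fun x y h => by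
  rw [← G.boundary_pow_position x, h, G.boundary_pow_position]

theorem boundary_apply (x : G.E) : G.boundary x = G.bar (G.next x) := rfl

theorem boundary_bar_tail : G.boundary (G.bar G.tail) = G.tail := by
  rw [boundary_apply, G.univalent, G.bar_bar]

theorem boundary_pow_last_succ :
    (G.boundary ^ (G.position (G.bar G.tail) + 1)) G.tail = G.tail := by
  rw [pow_succ', Equiv.Perm.mul_apply, boundary_pow_position, boundary_bar_tail]

/-- If the i-th edge already occurred at an earlier position j, the cycle would close after i - j
steps, and cutting out this loop would reach `bar tail` before its own position. -/
theorem position_boundary_pow {i : ℕ} (hi : i ≤ G.position (G.bar G.tail)) :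
    G.position ((G.boundary ^ i) G.tail) = i := by
  refine le_antisymm (position_le rfl) (not_lt.mp fun h => ?_)
  set j := G.position ((G.boundary ^ i) G.tail) with hj
  have h1 : (G.boundary ^ (i - j)) G.tail = G.tail := by
    have h2 := G.boundary_pow_position ((G.boundary ^ i) G.tail)
    rw [← hj, ← Nat.add_sub_cancel' h.le, pow_add, Equiv.Perm.mul_apply] at h2
    exact ((G.boundary ^ j).injective h2).symm
  have h3 := G.boundary_pow_position (G.bar G.tail)
  rw [← Nat.sub_add_cancel (show i - j ≤ G.position (G.bar G.tail) by omega), pow_add,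
    Equiv.Perm.mul_apply, h1] at h3
  have := position_le h3
  omega

theorem position_le_last (x : G.E) : G.position x ≤ G.position (G.bar G.tail) := by
  by_contra h
  push Not at h
  have h1 := G.boundary_pow_position x
  rw [← Nat.sub_add_cancel (Nat.succ_le_of_lt h), pow_add, Equiv.Perm.mul_apply,
    Nat.succ_eq_add_one, boundary_pow_last_succ] at h1
  have := position_le h1
  omega

variable {G}

theorem position_lt_last {x : G.E} (hx : x ≠ G.bar G.tail) :
    G.position x < G.position (G.bar G.tail) :=
  lt_of_le_of_ne (G.position_le_last x) fun h => hx (G.position_injective h)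

theorem position_bar_next {x : G.E} (hx : x ≠ G.bar G.tail) :
    G.position (G.bar (G.next x)) = G.position x + 1 := by
  have h : G.bar (G.next x) = (G.boundary ^ (G.position x + 1)) G.tail := by
    rw [pow_succ', Equiv.Perm.mul_apply, boundary_pow_position, boundary_apply]
  rw [h, position_boundary_pow]
  exact position_lt_last hx

theorem exists_position_eq_succ {x : G.E} (hx : x ≠ G.tail) :
    ∃ y, y ≠ G.bar G.tail ∧ G.bar x = G.next y ∧ G.position x = G.position y + 1 := by
  obtain ⟨y, rfl⟩ := G.boundary.surjective x
  have hy : y ≠ G.bar G.tail := fun h => hx (by rw [h, boundary_bar_tail])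
  exact ⟨y, hy, by rw [boundary_apply, G.bar_bar], position_bar_next hy⟩

theorem next_ne_bar_tail {x : G.E} (hx : x ≠ G.bar G.tail) : G.next x ≠ G.bar G.tail :=
  fun h => hx (G.next.injective (h.trans G.univalent.symm))

theorem path_eq (x : G.E) (i : ℕ) : G.path x i = (G.boundary ^ (G.position x + i)) G.tail := by
  rw [path, add_comm, pow_add, Equiv.Perm.mul_apply, boundary_pow_position]

theorem path_succ (x : G.E) (i : ℕ) : G.path x (i + 1) = G.bar (G.next (G.path x i)) := by
  rw [path, pow_succ', Equiv.Perm.mul_apply, boundary_apply, path]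

theorem position_path {x : G.E} {i : ℕ} (h : G.position x + i ≤ G.position (G.bar G.tail)) :
    G.position (G.path x i) = G.position x + i := by
  rw [path_eq, position_boundary_pow _ h]

theorem path_pathLength (x : G.E) : G.path x (G.pathLength x) = G.bar x := by
  classical exact Nat.find_spec (G.exists_boundary_pow x (G.bar x))

theorem pathLength_le {x : G.E} {k : ℕ} (h : G.path x k = G.bar x) : G.pathLength x ≤ k := by
  classical exact Nat.find_min' (G.exists_boundary_pow x (G.bar x)) h

theorem pathLength_of_lt {x : G.E} (h : G.position x < G.position (G.bar x)) :
    G.position x + G.pathLength x = G.position (G.bar x) := by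
  have h1 := G.position_le_last (G.bar x)
  have h2 : G.path x (G.position (G.bar x) - G.position x) = G.bar x := by
    rw [path_eq, Nat.add_sub_cancel' h.le, boundary_pow_position]
  have h3 := pathLength_le h2
  have h4 := position_path (x := x) (i := G.pathLength x) (by omega)
  rw [path_pathLength] at h4
  exact h4.symm

/-- Cut open between `bar tail` and `tail`, the boundary cycle becomes a linear order. A path avoids
the tail exactly when it does not run over the end. -/
theorem avoidsTail_iff {x : G.E} : G.AvoidsTail x ↔ G.position x < G.position (G.bar x) := by
  constructor
  · intro h
    by_contra hlt
    have h1 := G.position_le_last x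
    have hne : G.position (G.bar x) ≠ G.position x := fun h => G.bar_ne x (G.position_injective h)
    refine h (G.position (G.bar G.tail) - G.position x) ?_ ?_
    · by_contra hlen
      have h2 := position_path (x := x) (i := G.pathLength x) (by omega)
      rw [path_pathLength] at h2
      omega
    · rw [path_eq, Nat.add_sub_cancel' h1, boundary_pow_position]
  · intro h i hi heq
    have h1 := pathLength_of_lt h
    have h2 := G.position_le_last (G.bar x)
    have h3 := position_path (x := x) (i := i) (by omega)
    rw [heq] at h3
    omega

theorem avoidsTail_bar {x : G.E} (h : ¬ G.AvoidsTail x) : G.AvoidsTail (G.bar x) := by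
  rw [avoidsTail_iff] at h ⊢
  rw [G.bar_bar]
  exact lt_of_le_of_ne (not_lt.mp h) fun h => G.bar_ne x (G.position_injective h)

theorem not_avoidsTail_bar {x : G.E} (h : G.AvoidsTail x) : ¬ G.AvoidsTail (G.bar x) := by
  rw [avoidsTail_iff] at h ⊢
  rw [G.bar_bar]
  exact h.asymm

/-- If `S x` is the sum of `c` over the corners along the path from `x` to `bar x`, extended
antisymmetrically to the edges whose path does not avoid the tail, then the sum of `S` over the
edges pointing into a trivalent vertex is the sum of `c` over the corners at this vertex. -/
theorem sum_vertex_eq {M : Type*} [AddCommGroup M] {c S : G.E → M}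
    (h1 : ∀ x, G.AvoidsTail x → S x = ∑ i ∈ Finset.range (G.pathLength x), c (G.path x i))
    (h2 : ∀ x, ¬ G.AvoidsTail x → S x = -S (G.bar x)) {x : G.E} (hx : x ≠ G.bar G.tail) :
    S x + S (G.next x) + S (G.next (G.next x)) =
      c x + c (G.next x) + c (G.next (G.next x)) := by
  -- The potential accumulates corner terms from the tail on, so that `S x` becomes the potential at
  -- `bar x` minus that at `x`, for both kinds of edges.
  set pot : ℕ → M := fun j => ∑ i ∈ Finset.range j, c ((G.boundary ^ i) G.tail) with hpot
  have h3 : ∀ x, G.AvoidsTail x → S x = pot (G.position (G.bar x)) - pot (G.position x) := by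
    intro x ha
    rw [h1 x ha, ← pathLength_of_lt (avoidsTail_iff.mp ha), hpot]
    simp only [Finset.sum_range_add, add_sub_cancel_left, path_eq]
  have h4 : ∀ x, S x = pot (G.position (G.bar x)) - pot (G.position x) := by
    intro x
    by_cases ha : G.AvoidsTail x
    · exact h3 x ha
    · rw [h2 x ha, h3 _ (avoidsTail_bar ha), G.bar_bar, neg_sub]
  -- The cycle steps from `x` to `bar (next x)`. The potential of each reversed edge at a vertex is
  -- therefore that of the preceding incoming edge plus one corner term, and the potentials cancel
  -- around the vertex.
  have h5 : ∀ x, x ≠ G.bar G.tail →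
      pot (G.position (G.bar (G.next x))) = pot (G.position x) + c x := by
    intro x hx
    rw [position_bar_next hx, hpot]
    simp only [Finset.sum_range_succ, boundary_pow_position]
  have hy := next_ne_bar_tail hx
  have h6 := h5 _ (next_ne_bar_tail hy)
  rw [(G.trivalent x hx).2] at h6
  rw [h4 x, h4 (G.next x), h4 (G.next (G.next x)), h5 x hx, h5 _ hy, h6]
  abel

end Position

/-! ### Existence, uniqueness and Lie values of the solution of the recursion. -/

section Recursion

variable {V : Type*} [AddCommGroup V] [Module ℚ V]

@[simp]
theorem comp_homogeneousPart (n k : ℕ) (X : CompletedTensorAlgebra V) :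
    comp k (homogeneousPart n X) = if k = n then comp k X else 0 :=
  comp_ofComp k (fun k => if k = n then comp k X else 0) _

@[simp]
theorem comp_ofDegreeOne (k : ℕ) (v : V) :
    comp k (ofDegreeOne v) = if k = 1 then TensorAlgebra.ι ℚ v else 0 :=
  comp_ofComp k (fun k => if k = 1 then TensorAlgebra.ι ℚ v else 0) _

variable {G : BorderedFatgraph.{u}} (m : G.E → V)

theorem comp_ellApprox_of_lt {n k : ℕ} (h : k < n) (x : G.E) :
    comp n (G.ellApprox m k x) = 0 := by
  match k with
  | 0 => exact comp_zero n
  | 1 => simp [ellApprox, h.ne']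
  | k + 2 =>
    rw [ellApprox, comp_add, comp_ellApprox_of_lt (by omega), comp_homogeneousPart,
      if_neg (by omega), add_zero]

theorem comp_zero_ellApprox (k : ℕ) (x : G.E) : comp 0 (G.ellApprox m k x) = 0 := by
  match k with
  | 0 => exact comp_zero 0
  | 1 => simp [ellApprox]
  | k + 2 =>
    rw [ellApprox, comp_add, comp_zero_ellApprox, comp_homogeneousPart, if_neg (by omega),
      add_zero]

theorem comp_ellApprox_succ {n k : ℕ} (h : n ≤ k) (x : G.E) :
    comp n (G.ellApprox m (k + 1) x) = comp n (G.ellApprox m k x) := by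
  cases k with
  | zero => obtain rfl := Nat.le_zero.mp h; simp [ellApprox]
  | succ k => rw [ellApprox, comp_add, comp_homogeneousPart, if_neg (by omega), add_zero]

theorem comp_ell_eq {n k : ℕ} (h : n ≤ k) (x : G.E) :
    comp n (G.ell m x) = comp n (G.ellApprox m k x) := by
  rw [ell, comp_ofComp]
  induction k, h using Nat.le_induction with
  | base => rfl
  | succ k hk ih => rw [ih, comp_ellApprox_succ m hk]

theorem ellApprox_sub_ell_mem (n : ℕ) (x : G.E) :
    G.ellApprox m n x - G.ell m x ∈ lowOrder V (n + 1) := by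
  intro k hk
  rw [comp_sub, comp_ell_eq m (Nat.lt_succ_iff.mp hk), sub_self]

theorem comp_zero_ell (x : G.E) : comp 0 (G.ell m x) = 0 := by
  rw [comp_ell_eq m le_rfl, comp_zero_ellApprox]

/-- The gain of one degree makes the recursion well founded; existence and uniqueness both rest on
it. -/
theorem pathSum_sub_mem {L L' : G.E → CompletedTensorAlgebra V} (h0 : ∀ x, comp 0 (L x) = 0)
    {n : ℕ} (hn : 1 ≤ n) (h : ∀ x, L' x - L x ∈ lowOrder V n) (x : G.E) :
    G.pathSum L' x - G.pathSum L x ∈ lowOrder V (n + 1) := by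
  rw [pathSum, pathSum, ← Finset.sum_sub_distrib]
  refine Submodule.sum_mem _ fun i _ => hausdorff_sub_mem hn (h0 _) ?_ (h _) ?_
  · rw [comp_neg, h0, neg_zero]
  · rw [neg_sub_neg, ← neg_sub]
    exact Submodule.neg_mem _ (h _)

theorem comp_pathSum (n : ℕ) (L : G.E → CompletedTensorAlgebra V) (x : G.E) :
    comp n (G.pathSum L x) = ∑ i ∈ Finset.range (G.pathLength x),
      comp n (hausdorff (L (G.path x i)) (-L (G.path x (i + 1)))) :=
  comp_sum _ _ _

theorem comp_ell_add_two (n : ℕ) (x : G.E) :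
    comp (n + 2) (G.ell m x) = comp (n + 2) (G.ellApprox m (n + 2) x) :=
  comp_ell_eq m le_rfl x

theorem solvesRecursion_ell : G.SolvesRecursion m (G.ell m) := by
  have key : ∀ n x, comp (n + 2) (G.pathSum (G.ellApprox m (n + 1)) x) =
      comp (n + 2) (G.pathSum (G.ell m) x) := fun n x =>
    comp_eq_of_sub_mem (pathSum_sub_mem (comp_zero_ell m) (Nat.le_add_left 1 _)
      (ellApprox_sub_ell_mem m (n + 1)) x) (Nat.lt_succ_self _)
  have h1 : ∀ n x, G.AvoidsTail x → comp (n + 2) (G.ell m x) = (-(1 / 3 : ℚ)) •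
      comp (n + 2) (G.pathSum (G.ell m) x) := by
    intro n x hx
    rw [comp_ell_add_two, ellApprox, comp_add, comp_ellApprox_of_lt m (Nat.lt_succ_self _),
      zero_add, comp_homogeneousPart, if_pos rfl, if_pos hx, comp_smul, key]
  refine fun x => ⟨comp_zero_ell m x, ?_, fun n hn => ?_⟩
  · rw [comp_ell_eq m le_rfl]
    simp [ellApprox]
  · obtain ⟨n, rfl⟩ := Nat.exists_eq_add_of_le' hn
    refine ⟨fun hx => by rw [← comp_pathSum, h1 n x hx], fun hx => ?_⟩
    rw [h1 n _ (avoidsTail_bar hx), comp_ell_add_two, ellApprox, comp_add,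
      comp_ellApprox_of_lt m (Nat.lt_succ_self _), zero_add, comp_homogeneousPart, if_pos rfl,
      if_neg hx, comp_smul, key, neg_smul, neg_neg]

variable {m}

theorem SolvesRecursion.unique {L L' : G.E → CompletedTensorAlgebra V}
    (h : G.SolvesRecursion m L) (h' : G.SolvesRecursion m L') : L = L' := by
  have key : ∀ n x, L x - L' x ∈ lowOrder V (n + 2) := by
    intro n
    induction n with
    | zero =>
      intro x k hk
      rw [comp_sub, sub_eq_zero]
      interval_cases k
      · rw [(h x).1, (h' x).1]
      · rw [(h x).2.1, (h' x).2.1]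
    | succ n ih =>
      have h1 : ∀ x, G.AvoidsTail x → comp (n + 2) (L x) = comp (n + 2) (L' x) := by
        intro x hx
        rw [((h x).2.2 _ (by omega)).1 hx, ((h' x).2.2 _ (by omega)).1 hx, ← comp_pathSum,
          ← comp_pathSum, comp_eq_of_sub_mem (pathSum_sub_mem (fun x => (h' x).1) (by omega) ih x)
            (Nat.lt_succ_self _)]
      intro x k hk
      rcases Nat.lt_succ_iff_lt_or_eq.mp hk with hk | rfl
      · exact ih x k hk
      rw [comp_sub, sub_eq_zero]
      by_cases hx : G.AvoidsTail x
      · exact h1 x hx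
      · rw [((h x).2.2 _ (by omega)).2 hx, ((h' x).2.2 _ (by omega)).2 hx,
          h1 _ (avoidsTail_bar hx)]
  funext x
  exact ext_comp fun n => comp_eq_of_sub_mem (key n x) (by omega)

variable (m) in
theorem ellApprox_mem_lieBelow (N k : ℕ) (x : G.E) : G.ellApprox m k x ∈ lieBelow V N := by
  have hpart : ∀ (n : ℕ) (X : CompletedTensorAlgebra V), X ∈ lieBelow V N →
      homogeneousPart n X ∈ lieBelow V N := fun n X hX => by
    refine ⟨?_, fun k hk => ?_⟩
    · rw [comp_homogeneousPart, hX.1, ite_self]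
    · rw [comp_homogeneousPart]
      split_ifs
      · exact hX.2 k hk
      · exact Submodule.zero_mem _
  match k with
  | 0 => exact Submodule.zero_mem _
  | 1 =>
    refine ⟨by simp [ellApprox], fun n _ => ?_⟩
    rw [ellApprox, comp_ofDegreeOne]
    split_ifs
    · exact ι_mem_freeLie _
    · exact Submodule.zero_mem _
  | k + 2 =>
    have hs : ∀ x, G.pathSum (G.ellApprox m (k + 1)) x ∈ lieBelow V N := fun x =>
      Submodule.sum_mem _ fun i _ => hausdorff_mem_lieBelow (ellApprox_mem_lieBelow N (k + 1) _)
        (Submodule.neg_mem _ (ellApprox_mem_lieBelow N (k + 1) _))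
    rw [ellApprox]
    refine Submodule.add_mem _ (ellApprox_mem_lieBelow N (k + 1) x) (hpart _ _ ?_)
    split_ifs
    · exact Submodule.smul_mem _ _ (hs _)
    · exact Submodule.smul_mem _ _ (hs _)

variable (m) in
theorem comp_ell_mem_freeLie (n : ℕ) (x : G.E) : comp n (G.ell m x) ∈ freeLie V := by
  rw [comp_ell_eq m le_rfl]
  exact (ellApprox_mem_lieBelow m (n + 1) n x).2 n n.lt_succ_self

/-- Exactly one of `x` and `bar x` has a path that avoids the tail, so the second clause of the
recursion always relates the two. -/
theorem SolvesRecursion.apply_bar {L : G.E → CompletedTensorAlgebra V}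
    (h : G.SolvesRecursion m L) (hm : ∀ x, m (G.bar x) = -m x) (x : G.E) :
    L (G.bar x) = -L x := by
  refine ext_comp fun n => ?_
  rw [comp_neg]
  match n with
  | 0 => rw [(h _).1, (h _).1, neg_zero]
  | 1 => rw [(h _).2.1, (h _).2.1, hm, map_neg]
  | n + 2 =>
    by_cases hx : G.AvoidsTail x
    · rw [((h _).2.2 _ (by omega)).2 (not_avoidsTail_bar hx), G.bar_bar]
    · rw [((h x).2.2 _ (by omega)).2 hx, neg_neg]

end Recursion

end BorderedFatgraph

/-! ### The vertex relation, degree by degree. -/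

section Corner

variable {V : Type*} [AddCommGroup V] [Module ℚ V]

/-- If `exp X exp Y exp Z = 1` holds up to terms of degree at least `n`, then in degree `n` its
failure is `X + Y + Z + h(X, Y)`. -/
theorem add_hausdorff_sub_mem {n : ℕ} (hn : 1 ≤ n) {X Y Z : CompletedTensorAlgebra V}
    (hX : comp 0 X = 0) (hY : comp 0 Y = 0) (hZ : comp 0 Z = 0)
    (h : expT X * expT Y * expT Z - 1 ∈ lowOrder V n) :
    X + Y + Z + hausdorff X Y - (expT X * expT Y * expT Z - 1) ∈ lowOrder V (n + 1) := by
  set w := expT X * expT Y * expT Z - 1 with hw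
  have hw0 : comp 0 w = 0 := h 0 hn
  have hZ' : comp 0 (-Z) = 0 := by simp [hZ]
  have e1 : expT X * expT Y = (1 + w) * expT (-Z) := by
    rw [hw, add_sub_cancel, mul_assoc, expT_mul_expT_neg hZ, mul_one]
  have e2 : expT (-Z) - 1 ∈ lowOrder V 1 := by simp [mem_lowOrder_one, comp_zero_expT]
  have h1 : expT (X + Y + hausdorff X Y) - expT (-Z + w) ∈ lowOrder V (n + 1) := by
    rw [hausdorff_spec, e1]
    convert Submodule.sub_mem _ (mul_mem_lowOrder h e2) (expT_add_sub_mem hn hZ' h) using 1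
    simp only [add_mul, one_mul, mul_sub, mul_one]
    abel
  have h2 := sub_mem_of_expT_sub_mem
    (by simp [hX, hY, comp_zero_hausdorff]) (by simp [hZ, hw0]) h1
  convert h2 using 1
  abel

/-- Rotating the product conjugates its failure by exp X, which is 1 in degree zero, so the failure
in degree n is unchanged. Since X + Y + Z is symmetric, `add_hausdorff_sub_mem` transfers this to h.
-/
theorem hausdorff_rotate_sub_mem {n : ℕ} (hn : 1 ≤ n) {X Y Z : CompletedTensorAlgebra V}
    (hX : comp 0 X = 0) (hY : comp 0 Y = 0) (hZ : comp 0 Z = 0)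
    (h : expT X * expT Y * expT Z - 1 ∈ lowOrder V n) :
    expT Y * expT Z * expT X - 1 ∈ lowOrder V n ∧
      hausdorff Y Z - hausdorff X Y ∈ lowOrder V (n + 1) := by
  have e : expT Y * expT Z * expT X - 1 =
      expT (-X) * (expT X * expT Y * expT Z - 1) * expT X := by
    have e1 := expT_neg_mul_expT hX
    rw [mul_sub, sub_mul, mul_one, e1, mul_assoc (expT X), ← mul_assoc (expT (-X)), e1, one_mul]
  have h1 : expT Y * expT Z * expT X - 1 ∈ lowOrder V n := by
    rw [e]
    exact mul_mem_lowOrder_left (mul_mem_lowOrder_right h _) _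
  refine ⟨h1, ?_⟩
  have h2 : expT Y * expT Z * expT X - 1 - (expT X * expT Y * expT Z - 1) ∈
      lowOrder V (n + 1) := by
    have e2 : expT X - 1 ∈ lowOrder V 1 := by simp [mem_lowOrder_one, comp_zero_expT]
    have e3 : expT (-X) - 1 ∈ lowOrder V 1 := by simp [mem_lowOrder_one, comp_zero_expT]
    have m1 := mul_mem_lowOrder_left (mul_mem_lowOrder e3 h) (expT X)
    rw [add_comm 1 n] at m1
    rw [e]
    generalize expT X * expT Y * expT Z - 1 = w at h m1
    convert Submodule.add_mem _ m1 (mul_mem_lowOrder h e2) using 1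
    simp only [sub_mul, one_mul, mul_sub, mul_one]
    abel
  have h3 := Submodule.sub_mem _ (Submodule.add_mem _ (add_hausdorff_sub_mem hn hY hZ hX h1) h2)
    (add_hausdorff_sub_mem hn hX hY hZ h)
  convert h3 using 1
  abel

end Corner

namespace BorderedFatgraph

variable {V : Type*} [AddCommGroup V] [Module ℚ V] {G : BorderedFatgraph.{u}} {m : G.E → V}

theorem SolvesRecursion.expT_vertex {L : G.E → CompletedTensorAlgebra V}
    (h : G.SolvesRecursion m L) (hbar : ∀ x, m (G.bar x) = -m x)
    (hvertex : ∀ x, x ≠ G.bar G.tail → m x + m (G.next x) + m (G.next (G.next x)) = 0)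
    {x : G.E} (hx : x ≠ G.bar G.tail) :
    expT (L x) * expT (L (G.next x)) * expT (L (G.next (G.next x))) = 1 := by
  have h0 : ∀ x, comp 0 (L x) = 0 := fun x => (h x).1
  suffices key : ∀ n x, x ≠ G.bar G.tail →
      expT (L x) * expT (L (G.next x)) * expT (L (G.next (G.next x))) - 1 ∈ lowOrder V (n + 1) by
    refine ext_comp fun n => comp_eq_of_sub_mem (key n x hx) n.lt_succ_self
  intro n
  induction n with
  | zero =>
    intro x _
    simp [mem_lowOrder_one, comp_zero_mul, comp_zero_expT]
  | succ n ih =>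
    intro x hx
    have hn : 1 ≤ n + 1 := by omega
    set c : G.E → TensorAlgebra ℚ V := fun u => comp (n + 1) (hausdorff (L u) (L (G.next u)))
      with hc
    have hrot : ∀ x, x ≠ G.bar G.tail → c (G.next x) = c x := fun x hx =>
      comp_eq_of_sub_mem (hausdorff_rotate_sub_mem hn (h0 _) (h0 _) (h0 _) (ih x hx)).2
        (Nat.lt_succ_self _)
    have hsum : comp (n + 1) (L x) + comp (n + 1) (L (G.next x)) +
        comp (n + 1) (L (G.next (G.next x))) = -c x := by
      rcases Nat.eq_zero_or_pos n with rfl | hn0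
      -- Degree one lies outside the recursion: here the markings cancel at the vertex and h has no
      -- linear part.
      · rw [(h _).2.1, (h _).2.1, (h _).2.1, ← map_add, ← map_add, hvertex x hx, map_zero, hc]
        simp only [zero_add]
        rw [comp_one_hausdorff (h0 _) (h0 _), neg_zero]
      -- The factor -3 clears the coefficient -1/3, so that `S` is a plain sum of corner terms. The
      -- three corner terms at the vertex are equal by `hrot`.
      · have h1 := sum_vertex_eq (c := c) (S := fun x => (-3 : ℚ) • comp (n + 1) (L x)) ?_ ?_ hx
        · rw [hrot _ (next_ne_bar_tail hx), hrot x hx, ← smul_add, ← smul_add] at h1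
          have h2 := congrArg (fun t => (-(1 / 3) : ℚ) • t) h1
          simp only [smul_smul] at h2
          norm_num at h2
          rw [h2]
          module
        · intro x hx
          rw [((h x).2.2 _ (by omega)).1 hx, smul_smul]
          norm_num
          refine Finset.sum_congr rfl fun i _ => ?_
          -- The next edge on the path is `bar (next f)`, so minus its ℓ is ℓ of `next f`: each
          -- summand is the term of an actual corner.
          rw [path_succ, h.apply_bar hbar, neg_neg]
        · intro x hx
          rw [((h x).2.2 _ (by omega)).2 hx, smul_neg]
    intro k hk
    rcases Nat.lt_succ_iff_lt_or_eq.mp hk with hk | rfl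
    · exact ih x hx k hk
    have h2 := comp_eq_of_sub_mem
      (add_hausdorff_sub_mem hn (h0 _) (h0 _) (h0 _) (ih x hx)) (Nat.lt_succ_self _)
    rw [← h2, comp_add, comp_add, comp_add, hsum]
    exact neg_add_cancel _

end BorderedFatgraph

/-! ### Residual finiteness and the Hopf property of free groups. -/

section Hopf

/-- The relation is a partial bijection, and on a finite set its domain and range have complements
of equal size. -/
theorem exists_perm_of_relation {X : Type*} [Finite X] (r : X → X → Prop)
    (h1 : ∀ p q q', r p q → r p q' → q = q') (h2 : ∀ p p' q, r p q → r p' q → p = p') :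
    ∃ σ : Equiv.Perm X, ∀ p q, r p q → σ p = q := by
  classical
  have := Fintype.ofFinite X
  let f : {p // ∃ q, r p q} → {q // ∃ p, r p q} := fun p => ⟨p.2.choose, p.1, p.2.choose_spec⟩
  have hf : Function.Bijective f := by
    constructor
    · intro p p' h
      have h3 := p'.2.choose_spec
      rw [← show p.2.choose = p'.2.choose from congrArg Subtype.val h] at h3
      exact Subtype.ext (h2 _ _ _ p.2.choose_spec h3)
    · rintro ⟨q, p, hpq⟩
      exact ⟨⟨p, q, hpq⟩, Subtype.ext (h1 _ _ _ (Exists.choose_spec (⟨q, hpq⟩ : ∃ q, r p q)) hpq)⟩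
  refine ⟨(Equiv.ofBijective f hf).extendSubtype, fun p q hpq => ?_⟩
  rw [Equiv.extendSubtype_apply_of_mem _ p ⟨q, hpq⟩]
  exact h1 _ _ _ (Exists.choose_spec (⟨q, hpq⟩ : ∃ q, r p q)) hpq

variable {α : Type*}

/-- Free groups are residually finite. -/
theorem exists_perm_hom_ne_one {w : FreeGroup α} (hw : w ≠ 1) :
    ∃ (n : ℕ) (ρ : FreeGroup α →* Equiv.Perm (Fin n)), ρ w ≠ 1 := by
  classical
  set L := w.toWord with hL
  have hred : ∀ (i : ℕ) (h : i + 1 < L.length) (a : α) (b : Bool),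
      L[i] = (a, b) → L[i + 1] = (a, !b) → False := by
    intro i h a b h1 h2
    have h3 : FreeGroup.IsReduced L := FreeGroup.isReduced_toWord
    have h4 := List.isChain_iff_getElem.mp h3 i h
    rw [h1, h2] at h4
    simpa using h4 rfl
  -- The points are the gaps between letters of the reduced word; the i-th letter must carry i + 1
  -- to i. Two conflicting demands on one generator would come from adjacent inverse letters.
  let r : α → Fin (L.length + 1) → Fin (L.length + 1) → Prop := fun a p q =>
    ∃ (i : ℕ) (h : i < L.length), (L[i] = (a, true) ∧ p.1 = i + 1 ∧ q.1 = i) ∨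
      (L[i] = (a, false) ∧ p.1 = i ∧ q.1 = i + 1)
  have hσ : ∀ a, ∃ σ : Equiv.Perm (Fin (L.length + 1)), ∀ p q, r a p q → σ p = q := by
    intro a
    refine exists_perm_of_relation (r a) ?_ ?_
    · rintro p q q' ⟨i, hi, ⟨h1, h2, h3⟩ | ⟨h1, h2, h3⟩⟩ ⟨j, hj, ⟨k1, k2, k3⟩ | ⟨k1, k2, k3⟩⟩
      · exact Fin.ext (by omega)
      · obtain rfl : j = i + 1 := by omega
        exact (hred i hj a true h1 k1).elim
      · obtain rfl : i = j + 1 := by omega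
        exact (hred j hi a true k1 h1).elim
      · exact Fin.ext (by omega)
    · rintro p p' q ⟨i, hi, ⟨h1, h2, h3⟩ | ⟨h1, h2, h3⟩⟩ ⟨j, hj, ⟨k1, k2, k3⟩ | ⟨k1, k2, k3⟩⟩
      · exact Fin.ext (by omega)
      · obtain rfl : i = j + 1 := by omega
        exact (hred j hi a false k1 h1).elim
      · obtain rfl : j = i + 1 := by omega
        exact (hred i hj a false h1 k1).elim
      · exact Fin.ext (by omega)
  choose σ hσ using hσ
  refine ⟨L.length + 1, FreeGroup.lift σ, fun h => ?_⟩
  -- Reading from the right, the suffix of length k moves the last point down by k, so a word acting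
  -- trivially has length zero.
  have key : ∀ k ≤ L.length,
      ((FreeGroup.lift σ (FreeGroup.mk (L.drop (L.length - k)))) (Fin.last _)).1 =
        L.length - k := by
    intro k
    induction k with
    | zero =>
      intro _
      rw [Nat.sub_zero, List.drop_length, ← FreeGroup.one_eq_mk, map_one, Equiv.Perm.one_apply,
        Fin.val_last]
    | succ k ih =>
      intro hk
      have hi : L.length - (k + 1) < L.length := by omega
      have hsucc : L.length - (k + 1) + 1 = L.length - k := by omega
      rw [List.drop_eq_getElem_cons hi, hsucc, ← List.singleton_append, ← FreeGroup.mul_mk,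
        map_mul, Equiv.Perm.mul_apply]
      have ihk := ih (by omega)
      set p := (FreeGroup.lift σ (FreeGroup.mk (L.drop (L.length - k)))) (Fin.last _) with hp
      rcases hlet : L[L.length - (k + 1)] with ⟨a, b⟩
      cases b with
      | true =>
        have : σ a p = ⟨L.length - (k + 1), by omega⟩ :=
          hσ a _ _ ⟨_, hi, Or.inl ⟨hlet, by omega, rfl⟩⟩
        simp [FreeGroup.lift_mk, this]
      | false =>
        have : σ a ⟨L.length - (k + 1), by omega⟩ = p :=
          hσ a _ _ ⟨_, hi, Or.inr ⟨hlet, rfl, by omega⟩⟩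
        simp [FreeGroup.lift_mk, ← this]
  have h1 := key L.length le_rfl
  have hmk : FreeGroup.mk L = w := FreeGroup.mk_toWord
  rw [Nat.sub_self, List.drop_zero, hmk, h, Equiv.Perm.one_apply,
    Fin.val_last] at h1
  exact hw (FreeGroup.toWord_eq_nil_iff.mp (List.length_eq_zero_iff.mp h1))

/-- Finitely generated free groups are Hopfian. -/
theorem freeGroup_injective_of_surjective [Finite α] {f : FreeGroup α →* FreeGroup α}
    (hf : Function.Surjective f) : Function.Injective f := by
  rw [injective_iff_map_eq_one]
  intro w hw
  by_contra hne
  obtain ⟨n, ρ, hρ⟩ := exists_perm_hom_ne_one hne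
  have : Finite (FreeGroup α →* Equiv.Perm (Fin n)) :=
    Finite.of_equiv _ (FreeGroup.lift (α := α) (β := Equiv.Perm (Fin n)))
  -- Precomposition with `f` is an injective self-map of a finite set, hence surjective. Every
  -- finite permutation representation thus factors through `f` and kills its kernel.
  have hinj : Function.Injective fun τ : FreeGroup α →* Equiv.Perm (Fin n) => τ.comp f :=
    fun τ τ' h => (MonoidHom.cancel_right hf).mp h
  obtain ⟨τ, rfl⟩ := Finite.surjective_of_injective hinj ρ
  exact hρ (by simp [hw])

end Hopf

/-! ### The spanning tree of first arrivals and its 2g complementary edges. -/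

namespace BorderedFatgraph

variable (G : BorderedFatgraph.{u})

/-- The vertices of a fatgraph. -/
abbrev Vertex : Type u := Quotient (Equiv.Perm.SameCycle.setoid G.next)

/-- The unoriented edges of a fatgraph. -/
abbrev Edge : Type u := Quotient (Equiv.Perm.SameCycle.setoid G.bar)

/-- The vertex into which an oriented edge points. -/
def target (x : G.E) : G.Vertex := Quotient.mk _ x

/-- The unoriented edge underlying an oriented edge. -/
def edge (x : G.E) : G.Edge := Quotient.mk _ x

theorem target_next (x : G.E) : G.target (G.next x) = G.target x :=
  Quotient.sound (Equiv.Perm.sameCycle_apply_left.mpr (Equiv.Perm.SameCycle.refl _ _))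

theorem edge_eq_iff {x y : G.E} : G.edge x = G.edge y ↔ y = x ∨ y = G.bar x := by
  constructor
  · intro h
    obtain ⟨i, hi⟩ : G.bar.SameCycle x y := Quotient.exact h
    have hsq : G.bar ^ (2 : ℤ) = 1 := by
      ext z
      rw [zpow_two, Equiv.Perm.mul_apply, G.bar_bar, Equiv.Perm.one_apply]
    rcases Int.even_or_odd' i with ⟨k, rfl | rfl⟩
    · rw [zpow_mul, hsq, one_zpow, Equiv.Perm.one_apply] at hi
      exact Or.inl hi.symm
    · rw [zpow_add, zpow_mul, hsq, one_zpow, one_mul, zpow_one] at hi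
      exact Or.inr hi.symm
  · rintro (rfl | rfl)
    · rfl
    · exact Quotient.sound (Equiv.Perm.sameCycle_apply_right.mpr (Equiv.Perm.SameCycle.refl _ _))

theorem exists_first (q : G.Vertex) :
    ∃ x, G.target x = q ∧ ∀ y, G.target y = q → G.position x ≤ G.position y := by
  have := G.finite
  obtain ⟨x, hx⟩ := q.exists_rep
  obtain ⟨y, hy, hmin⟩ := Set.exists_min_image {y | G.target y = q} G.position (Set.toFinite _)
    ⟨x, hx⟩
  exact ⟨y, hy, hmin⟩

/-- The oriented edge along which the boundary cycle, started at the tail, first arrives at a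
vertex. -/
noncomputable def first (q : G.Vertex) : G.E := (G.exists_first q).choose

theorem target_first (q : G.Vertex) : G.target (G.first q) = q := (G.exists_first q).choose_spec.1

theorem position_first_le {q : G.Vertex} {y : G.E} (hy : G.target y = q) :
    G.position (G.first q) ≤ G.position y :=
  (G.exists_first q).choose_spec.2 y hy

/-- The cycle leaves q' along `first q`, so the preceding edge already points into q'. Hence two
first arrivals are never the two orientations of one edge. -/
theorem position_first_lt {q q' : G.Vertex} (hq' : q' ≠ G.target (G.bar G.tail))
    (h : G.bar (G.first q) = G.first q') :
    G.position (G.first q') < G.position (G.first q) := by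
  have hne : G.first q ≠ G.tail := fun ht => hq' (by rw [← ht, h, target_first])
  obtain ⟨y, -, hy, hp⟩ := exists_position_eq_succ hne
  have : G.target y = q' := by rw [← target_next, ← hy, h, target_first]
  have := G.position_first_le this
  omega

/-- The edge along which the boundary cycle first arrives at a trivalent vertex. These edges form
a spanning tree. -/
noncomputable def treeEdge (q : {q : G.Vertex // q ≠ G.target (G.bar G.tail)}) : G.Edge :=
  G.edge (G.first q.1)

theorem treeEdge_injective : Function.Injective G.treeEdge := by
  rintro ⟨q, hq⟩ ⟨q', hq'⟩ h
  rw [treeEdge, treeEdge, edge_eq_iff] at h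
  rcases h with h | h
  · refine Subtype.ext ?_
    have := congrArg G.target h
    rwa [target_first, target_first, eq_comm] at this
  · have h1 := G.position_first_lt hq' h.symm
    have h2 := G.position_first_lt hq (show G.bar (G.first q') = G.first q by
      simp only at h; rw [h, G.bar_bar])
    exact absurd h1 h2.asymm

/-- The edges outside the spanning tree. -/
abbrev CoEdge : Type u := {e : G.Edge // e ∉ Set.range G.treeEdge}

/-- With one tree edge per trivalent vertex, E is V - 1 plus the number of complementary edges.
Inserting this and the single boundary cycle into V - E + F = 2 - 2g leaves 2g. -/
theorem card_coEdge {g : ℕ} (hg : G.HasGenus g) : Nat.card G.CoEdge = 2 * g := by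
  classical
  have := G.finite
  have h1 : numCycles G.boundary = 1 := by
    rw [numCycles, Nat.card_eq_one_iff_unique]
    exact ⟨⟨fun a b => Quotient.inductionOn₂ a b fun x y => Quotient.sound (G.one_boundary x y)⟩,
      ⟨Quotient.mk _ G.tail⟩⟩
  have h2 : numCycles G.next = Nat.card {q : G.Vertex // q ≠ G.target (G.bar G.tail)} + 1 := by
    rw [numCycles, ← Nat.card_congr
      (Equiv.sumCompl fun q : G.Vertex => q = G.target (G.bar G.tail)), Nat.card_sum,
      Nat.card_unique, add_comm]
  have h3 : numCycles G.bar =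
      Nat.card {q : G.Vertex // q ≠ G.target (G.bar G.tail)} + Nat.card G.CoEdge := by
    rw [numCycles, ← Nat.card_congr (Equiv.sumCompl fun e : G.Edge => e ∈ Set.range G.treeEdge),
      Nat.card_sum, Nat.card_congr (Equiv.ofInjective _ G.treeEdge_injective)]
  rw [Fatgraph.HasGenus, h1, h2, h3] at hg
  omega

variable {G} in
/-- The edges outside the spanning tree generate the fundamental group. -/
theorem mem_closure_coEdge {M : Type*} [Group M] {f : G.E → M}
    (hbar : ∀ x, f (G.bar x) * f x = 1)
    (hvertex : ∀ x, x ≠ G.bar G.tail → f x * f (G.next x) * f (G.next (G.next x)) = 1)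
    (x : G.E) : f x ∈ Subgroup.closure (Set.range fun s : G.CoEdge => f s.1.out) := by
  set K := Subgroup.closure (Set.range fun s : G.CoEdge => f s.1.out) with hK
  have hinv : ∀ x, f (G.bar x) = (f x)⁻¹ := fun x => eq_inv_of_mul_eq_one_left (hbar x)
  have hbarK : ∀ x, f (G.bar x) ∈ K ↔ f x ∈ K := fun x => by rw [hinv, Subgroup.inv_mem_iff]
  have hedge : ∀ x y, G.edge x = G.edge y → f x ∈ K → f y ∈ K := by
    intro x y h hx
    rcases G.edge_eq_iff.mp h with rfl | rfl
    · exact hx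
    · exact (hbarK x).mpr hx
  have hco : ∀ x, G.edge x ∉ Set.range G.treeEdge → f x ∈ K := fun x hx =>
    hedge _ x (Quotient.out_eq (G.edge x)) (Subgroup.subset_closure ⟨⟨G.edge x, hx⟩, rfl⟩)
  -- Induction from the latest first arrival backwards. The other two edges into the vertex are
  -- complementary edges or reversed first arrivals at vertices reached later, and the vertex
  -- relation then gives the remaining edge.
  have htree : ∀ (n : ℕ) (q : G.Vertex), q ≠ G.target (G.bar G.tail) →
      G.position (G.bar G.tail) - G.position (G.first q) < n → f (G.first q) ∈ K := by
    intro n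
    induction n with
    | zero => intro q _ h; exact absurd h (Nat.not_lt_zero _)
    | succ n ih =>
      intro q hq hn
      set x := G.first q with hx
      have hxq : G.target x = q := G.target_first q
      have hxt : x ≠ G.bar G.tail := fun h => hq (by rw [← hxq, h])
      have hyt := next_ne_bar_tail hxt
      have hother : ∀ y, G.target y = q → y ≠ x → G.position x < G.position (G.bar y) →
          f y ∈ K := by
        intro y hyq hyx hlt
        by_cases hy : G.edge y ∈ Set.range G.treeEdge
        · obtain ⟨⟨q', hq'⟩, h⟩ := hy
          rcases G.edge_eq_iff.mp h with h | h
          · refine absurd ?_ hyx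
            rw [h, hx]
            rw [h, target_first] at hyq
            exact congrArg G.first hyq
          · have hb : G.bar y = G.first q' := by rw [h, G.bar_bar]
            rw [← hbarK, hb]
            refine ih q' hq' ?_
            rw [← hb]
            have := G.position_le_last (G.bar y)
            omega
        · exact hco y hy
      have htri := G.trivalent x hxt
      have hy : f (G.next x) ∈ K := by
        refine hother _ (by rw [target_next, hxq]) htri.1 ?_
        rw [position_bar_next hxt]
        exact Nat.lt_succ_self _
      have hz : f (G.next (G.next x)) ∈ K := by
        refine hother _ (by rw [target_next, target_next, hxq]) (fun h => ?_) ?_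
        · have h3 := htri.2
          rw [h] at h3
          exact htri.1 h3
        -- The reversed third edge follows `next x` on the cycle, and `next x` arrives at the vertex
        -- no earlier than the first arrival `x`.
        · rw [position_bar_next hyt]
          exact Nat.lt_succ_of_le (G.position_first_le (by rw [target_next, hxq]))
      have hv := hvertex x hxt
      rw [mul_assoc] at hv
      rw [eq_inv_of_mul_eq_one_left hv]
      exact Subgroup.inv_mem _ (Subgroup.mul_mem _ hy hz)
  by_cases hx : G.edge x ∈ Set.range G.treeEdge
  · obtain ⟨⟨q, hq⟩, h⟩ := hx
    exact hedge _ x h (htree _ q hq (Nat.lt_succ_self _))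
  · exact hco x hx

end BorderedFatgraph

/-! ### Rational homology and the Magnus condition on generators. -/

section Homology

variable {F : Type*} [Group F]

theorem homologyClass_mul (a b : F) :
    homologyClass (a * b) = homologyClass a + homologyClass b := by
  simp only [homologyClass, map_mul, ofMul_mul, TensorProduct.tmul_add]

theorem homologyClass_one : homologyClass (1 : F) = 0 := by
  simp only [homologyClass, map_one, ofMul_one, TensorProduct.tmul_zero]

theorem homologyMap_homologyClass (φ : MulAut F) (a : F) :
    homologyMap φ (homologyClass a) = homologyClass (φ a) := by
  rw [homologyMap, homologyClass, LinearMap.baseChange_tmul]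
  rfl

theorem isGeneralizedMagnusExpansion_of_closure
    {θ : F →* CompletedTensorAlgebra (RatHomology F)} {s : Set F} (hs : Subgroup.closure s = ⊤)
    (h : ∀ a ∈ s, comp 0 (θ a) = 1 ∧ comp 1 (θ a) = TensorAlgebra.ι ℚ (homologyClass a)) :
    IsGeneralizedMagnusExpansion θ := by
  intro a
  have ha : a ∈ Subgroup.closure s := by rw [hs]; exact Subgroup.mem_top a
  induction ha using Subgroup.closure_induction with
  | mem a ha => exact h a ha
  | one => rw [map_one, homologyClass_one, map_zero]; simp [comp_one]
  | mul a b _ _ iha ihb =>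
    rw [map_mul, comp_zero_mul, comp_one_mul, iha.1, iha.2, ihb.1, ihb.2, homologyClass_mul,
      map_add, one_mul, one_mul, mul_one]
    exact ⟨rfl, add_comm _ _⟩
  | inv a _ iha =>
    have h1 : θ a⁻¹ * θ a = 1 := by rw [← map_mul, inv_mul_cancel, map_one]
    have h2 : homologyClass a⁻¹ = -homologyClass a := by
      rw [eq_neg_iff_add_eq_zero, ← homologyClass_mul, inv_mul_cancel, homologyClass_one]
    have h3 := congrArg (comp 0) h1
    have h4 := congrArg (comp 1) h1
    rw [comp_zero_mul, iha.1, mul_one, comp_zero_one] at h3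
    rw [comp_one_mul, iha.1, iha.2, h3, mul_one, one_mul, comp_one, if_neg one_ne_zero] at h4
    exact ⟨h3, by rw [h2, map_neg, eq_neg_iff_add_eq_zero, add_comm, h4]⟩

end Homology

/-! ### Transport of solutions along isomorphisms and linear maps. -/

namespace BorderedFatgraph

variable {G G' : BorderedFatgraph.{u}}

/-- `bar tail` is the only fixed point of `next`, so isomorphisms need not be asked to preserve the
tail. -/
theorem map_bar_tail (e : G.E ≃ G'.E)
    (hnext : ∀ x, e (G.next x) = G'.next (e x)) : e (G.bar G.tail) = G'.bar G'.tail := by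
  by_contra h
  refine (G'.trivalent _ h).1 ?_
  rw [← hnext, G.univalent]

theorem map_path (e : G.E ≃ G'.E) (hbar : ∀ x, e (G.bar x) = G'.bar (e x))
    (hnext : ∀ x, e (G.next x) = G'.next (e x))
    (x : G.E) (i : ℕ) : e (G.path x i) = G'.path (e x) i := by
  induction i with
  | zero => rfl
  | succ i ih => rw [path_succ, path_succ, hbar, hnext, ih]

theorem map_pathLength (e : G.E ≃ G'.E) (hbar : ∀ x, e (G.bar x) = G'.bar (e x))
    (hnext : ∀ x, e (G.next x) = G'.next (e x))
    (x : G.E) : G'.pathLength (e x) = G.pathLength x := by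
  refine le_antisymm (pathLength_le ?_) (pathLength_le (e.injective ?_))
  · rw [← map_path e hbar hnext, path_pathLength, hbar]
  · rw [map_path e hbar hnext, path_pathLength, hbar]

theorem map_avoidsTail (e : G.E ≃ G'.E) (hbar : ∀ x, e (G.bar x) = G'.bar (e x))
    (hnext : ∀ x, e (G.next x) = G'.next (e x))
    (x : G.E) : G'.AvoidsTail (e x) ↔ G.AvoidsTail x := by
  simp only [AvoidsTail, map_pathLength e hbar hnext, ← map_path e hbar hnext,
    ← map_bar_tail e hnext, ne_eq, e.injective.eq_iff]

variable {V : Type*} [AddCommGroup V] [Module ℚ V]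

theorem SolvesRecursion.comp_equiv (e : G.E ≃ G'.E) (hbar : ∀ x, e (G.bar x) = G'.bar (e x))
    (hnext : ∀ x, e (G.next x) = G'.next (e x))
    {m : G'.E → V} {L : G'.E → CompletedTensorAlgebra V}
    (h : G'.SolvesRecursion m L) : G.SolvesRecursion (m ∘ e) (L ∘ e) := by
  refine fun x => ⟨(h _).1, (h _).2.1, fun n hn => ⟨fun hx => ?_, fun hx => ?_⟩⟩
  · have := ((h (e x)).2.2 n hn).1 ((map_avoidsTail e hbar hnext x).mpr hx)
    simpa only [Function.comp_apply, map_pathLength e hbar hnext, map_path e hbar hnext] using this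
  · have := ((h (e x)).2.2 n hn).2 (mt (map_avoidsTail e hbar hnext x).mp hx)
    simpa only [Function.comp_apply, hbar] using this

/-- The induced map preserves degrees and, being a homomorphism of algebras compatible with exp and
log, commutes with h. -/
theorem SolvesRecursion.map {W : Type*} [AddCommGroup W] [Module ℚ W] (f : V →ₗ[ℚ] W)
    {m : G.E → V} {L : G.E → CompletedTensorAlgebra V} (h : G.SolvesRecursion m L) :
    G.SolvesRecursion (f ∘ m) fun x => completedTensorHom f (L x) := by
  simp only [SolvesRecursion]
  refine fun x => ⟨?_, ?_, fun n hn => ⟨fun hx => ?_, fun hx => ?_⟩⟩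
  · rw [completedTensorHom_apply, comp_completedTensorMap, (h x).1, map_zero]
  · rw [completedTensorHom_apply, comp_completedTensorMap, (h x).2.1, tensorMap,
      TensorAlgebra.lift_ι_apply]
    rfl
  · rw [completedTensorHom_apply, comp_completedTensorMap, ((h x).2.2 n hn).1 hx, map_smul,
      map_sum]
    simp only [← map_neg, ← completedTensorHom_hausdorff]
    simp only [completedTensorHom_apply, comp_completedTensorMap]
  · rw [completedTensorHom_apply, completedTensorHom_apply, comp_completedTensorMap,
      comp_completedTensorMap, ((h x).2.2 n hn).2 hx, map_neg]

end BorderedFatgraph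

/-! ### Extension along the marking and equivariance. -/

namespace MarkedFatgraph

variable {g : ℕ} (G : MarkedFatgraph.{u} g)

theorem hMarking_bar (x : G.E) : G.hMarking (G.bar x) = -G.hMarking x := by
  rw [eq_neg_iff_add_eq_zero, hMarking, hMarking, ← homologyClass_mul, G.orientation,
    homologyClass_one]

theorem hMarking_vertex (x : G.E) (hx : x ≠ G.bar G.tail) :
    G.hMarking x + G.hMarking (G.next x) + G.hMarking (G.next (G.next x)) = 0 := by
  rw [hMarking, hMarking, hMarking, ← homologyClass_mul, ← homologyClass_mul, G.vertex x hx,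
    homologyClass_one]

/-- `θ(x) = exp (ℓ(x))` as a unit of the completed tensor algebra. -/
noncomputable def thetaUnit (x : G.E) :
    (CompletedTensorAlgebra (RatHomology (SurfaceGroup g)))ˣ where
  val := G.theta x
  inv := expT (-G.ell G.hMarking x)
  val_inv := expT_mul_expT_neg (BorderedFatgraph.comp_zero_ell _ x)
  inv_val := expT_neg_mul_expT (BorderedFatgraph.comp_zero_ell _ x)

theorem thetaUnit_bar (x : G.E) : G.thetaUnit (G.bar x) * G.thetaUnit x = 1 := by
  refine Units.ext ?_
  change expT (G.ell G.hMarking (G.bar x)) * expT (G.ell G.hMarking x) = 1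
  rw [(BorderedFatgraph.solvesRecursion_ell _).apply_bar G.hMarking_bar]
  exact expT_neg_mul_expT (BorderedFatgraph.comp_zero_ell _ x)

theorem thetaUnit_vertex (x : G.E) (hx : x ≠ G.bar G.tail) :
    G.thetaUnit x * G.thetaUnit (G.next x) * G.thetaUnit (G.next (G.next x)) = 1 :=
  Units.ext ((BorderedFatgraph.solvesRecursion_ell _).expT_vertex G.hMarking_bar
    G.hMarking_vertex hx)

/-- A map on oriented edges that satisfies the relations of a marking extends along the
marking. -/
theorem exists_extension {M : Type*} [Group M] {f : G.E → M}
    (hbar : ∀ x, f (G.bar x) * f x = 1)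
    (hvertex : ∀ x, x ≠ G.bar G.tail → f x * f (G.next x) * f (G.next (G.next x)) = 1) :
    ∃ θ : SurfaceGroup g →* M, ∀ x, θ (G.marking x) = f x := by
  have := G.finite
  let F : FreeGroup G.CoEdge →* SurfaceGroup g × M :=
    FreeGroup.lift fun s => (G.marking s.1.out, f s.1.out)
  have hF : ∀ x, ∃ w, F w = (G.marking x, f x) := by
    intro x
    -- Pairing the marking with `f` in a product group yields, for each edge, one word in the
    -- complementary edges that represents both values.
    have := BorderedFatgraph.mem_closure_coEdge (G := G.toBorderedFatgraph)
      (f := fun x => (G.marking x, f x)) (fun x => Prod.ext (G.orientation x) (hbar x))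
      (fun x hx => Prod.ext (G.vertex x hx) (hvertex x hx)) x
    rwa [← FreeGroup.range_lift_eq_closure] at this
  let p : FreeGroup G.CoEdge →* SurfaceGroup g := (MonoidHom.fst _ _).comp F
  have hp : Function.Surjective p := by
    rw [← MonoidHom.range_eq_top, eq_top_iff, ← G.full_rank, Subgroup.closure_le]
    rintro _ ⟨x, rfl⟩
    obtain ⟨w, hw⟩ := hF x
    exact ⟨w, congrArg Prod.fst hw⟩
  -- Both free groups have rank 2g, so the surjection `p` becomes an endomorphism of one free group,
  -- and the Hopf property makes it injective.
  obtain ⟨e⟩ : Nonempty (Fin g ⊕ Fin g ≃ G.CoEdge) := by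
    rw [← Finite.card_eq, G.card_coEdge G.genus, Nat.card_sum, Nat.card_fin, two_mul]
  have hpe : Function.Injective (p.comp (FreeGroup.freeGroupCongr e).toMonoidHom) :=
    freeGroup_injective_of_surjective (hp.comp (FreeGroup.freeGroupCongr e).surjective)
  have hpi : Function.Injective p := by
    intro v w h
    obtain ⟨v, rfl⟩ := (FreeGroup.freeGroupCongr e).surjective v
    obtain ⟨w, rfl⟩ := (FreeGroup.freeGroupCongr e).surjective w
    exact congrArg _ (hpe h)
  let P := MulEquiv.ofBijective p ⟨hpi, hp⟩
  refine ⟨((MonoidHom.snd _ _).comp F).comp P.symm.toMonoidHom, fun x => ?_⟩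
  obtain ⟨w, hw⟩ := hF x
  have h1 : P.symm (G.marking x) = w := by
    rw [MulEquiv.symm_apply_eq]
    exact (congrArg Prod.fst hw).symm
  change (F (P.symm (G.marking x))).2 = f x
  rw [h1, hw]

theorem exists_magnus :
    ∃ θ : SurfaceGroup g →* CompletedTensorAlgebra (RatHomology (SurfaceGroup g)),
    ∀ x, θ (G.marking x) = G.theta x := by
  -- The extension needs a group as target, hence the passage through units.
  obtain ⟨θ, hθ⟩ := G.exists_extension G.thetaUnit_bar G.thetaUnit_vertex
  refine ⟨(Units.coeHom _).comp θ, fun x => ?_⟩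
  rw [MonoidHom.comp_apply, hθ]
  rfl

theorem hom_ext {M : Type*} [Monoid M] {θ θ' : SurfaceGroup g →* M}
    (h : ∀ x, θ (G.marking x) = θ' (G.marking x)) : θ = θ' := by
  refine MonoidHom.eq_of_eqOn_dense G.full_rank ?_
  rintro _ ⟨x, rfl⟩
  exact h x

theorem comp_theta (x : G.E) : comp 0 (G.theta x) = 1 ∧
    comp 1 (G.theta x) = TensorAlgebra.ι ℚ (homologyClass (G.marking x)) := by
  refine ⟨comp_zero_expT _, ?_⟩
  have h := BorderedFatgraph.solvesRecursion_ell G.hMarking x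
  rw [theta, comp_one_expT h.1, h.2.1]
  rfl

variable {G} in
theorem theta_hIso {G' : MarkedFatgraph.{u} g} (e : G.HIso G') (x : G.E) :
    G'.theta (e.toEquiv x) = G.theta x := by
  have h := (BorderedFatgraph.solvesRecursion_ell G'.hMarking).comp_equiv
    (G := G.toBorderedFatgraph) e.toEquiv e.map_bar e.map_next
  rw [show G'.hMarking ∘ e.toEquiv = G.hMarking from funext e.map_hMarking] at h
  exact congrArg expT (congrFun (h.unique (BorderedFatgraph.solvesRecursion_ell G.hMarking)) x)

/-- The map induced by φ⁻¹ carries the H-marking of φ(G) to that of G, hence one solution of the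
recursion to the other by uniqueness. -/
theorem theta_act (φ : mappingClassGroup g) (x : G.E) :
    completedTensorMap (homologyMap (φ⁻¹).1) ((G.act φ).theta x) = G.theta x := by
  have h := (BorderedFatgraph.solvesRecursion_ell (G.act φ).hMarking).map (homologyMap (φ⁻¹).1)
  have hm : ⇑(homologyMap (φ⁻¹).1) ∘ (G.act φ).hMarking = G.hMarking := by
    funext x
    change homologyMap (φ⁻¹).1 (homologyClass (φ.1 (G.marking x))) = homologyClass (G.marking x)
    rw [homologyMap_homologyClass]
    congr 1
    exact MulAut.inv_apply_self _ φ.1 _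
  rw [hm] at h
  have hL := BorderedFatgraph.SolvesRecursion.unique (G := G.toBorderedFatgraph) h
    (BorderedFatgraph.solvesRecursion_ell G.hMarking)
  exact (completedTensorHom_expT _ _).trans (congrArg expT (congrFun hL x))

end MarkedFatgraph

end FatgraphMagnus

theorem theorem4p2 (g : ℕ) (hg : 0 < g) :
    -- the recursive definition is well posed, and `ℓ` takes values in the free Lie algebra
    (∀ G : MarkedFatgraph.{u} g,
      G.SolvesRecursion G.hMarking (G.ell G.hMarking) ∧
      (∀ L, G.SolvesRecursion G.hMarking L → L = G.ell G.hMarking) ∧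
      ∀ (x : G.E) (n : ℕ), comp n (G.ell G.hMarking x) ∈ freeLie (RatHomology (SurfaceGroup g))) ∧
    -- the fatgraph Magnus expansions `Θ G`
    ∃ Θ : MarkedFatgraph.{u} g →
        (SurfaceGroup g →* CompletedTensorAlgebra (RatHomology (SurfaceGroup g))),
      (∀ G, IsGeneralizedMagnusExpansion (Θ G)) ∧
      -- `Θ G` extends the map `x ↦ exp (ℓ(x))` on oriented edges, and it is the only extension
      (∀ G x, Θ G (G.marking x) = G.theta x) ∧
      (∀ G (θ : SurfaceGroup g →* CompletedTensorAlgebra (RatHomology (SurfaceGroup g))),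
        (∀ x, θ (G.marking x) = G.theta x) → θ = Θ G) ∧
      -- on oriented edges it depends only on the combinatorics and the `H`-marking
      (∀ (G G' : MarkedFatgraph.{u} g) (e : G.HIso G') (x : G.E),
        Θ G' (G'.marking (e.toEquiv x)) = Θ G (G.marking x)) ∧
      -- equivariance under the mapping class group
      (∀ (φ : mappingClassGroup g) (G : MarkedFatgraph.{u} g) (a : SurfaceGroup g),
        Θ G a = completedTensorMap (homologyMap (φ⁻¹).1) (Θ (G.act φ) (φ.1 a))) := by
  refine ⟨fun G => ⟨BorderedFatgraph.solvesRecursion_ell _,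
    fun L hL => hL.unique (BorderedFatgraph.solvesRecursion_ell _),
    fun x n => BorderedFatgraph.comp_ell_mem_freeLie _ n x⟩, ?_⟩
  choose Θ hΘ using fun G : MarkedFatgraph.{u} g => G.exists_magnus
  refine ⟨Θ, fun G => ?_, hΘ, fun G θ hθ => G.hom_ext fun x => by rw [hθ, hΘ],
    fun G G' e x => by rw [hΘ, hΘ, MarkedFatgraph.theta_hIso], fun φ G a => ?_⟩
  · refine isGeneralizedMagnusExpansion_of_closure G.full_rank ?_
    rintro _ ⟨x, rfl⟩
    rw [hΘ]
    exact G.comp_theta x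
  -- Both sides are homomorphisms on π₁, so it suffices to compare them on the edge markings of `G`,
  -- which generate.
  · have h : Θ G = ((completedTensorHom (homologyMap (φ⁻¹).1)).toMonoidHom.comp
        (Θ (G.act φ))).comp (MulEquiv.toMonoidHom φ.1) := by
      refine G.hom_ext fun x => ?_
      rw [hΘ, ← G.theta_act φ]
      exact congrArg _ (hΘ (G.act φ) x).symm
    exact DFunLike.congr_fun h a
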